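/- Let $X$ be a standard Borel space, let $\mathcal R$ be a Borel equivalence relation on $X$ with countable classes, and let $(\mathcal R_i)_{i\in I}$ be a countable family of Borel equivalence relations on $X$ such that $\mathcal R=\star_{i\in I}\mathcal R_i$. Here a relation on a Borel subset of $X$ is called a subrelation of $\mathcal R$ if its graph is contained in $\mathcal R$. An equivalence relation $\mathcal Q$ on $X$ is the *free product* $\star_{j\in J}\mathcal E_j$ of a countable family of Borel equivalence relations $\mathcal E_j$, each defined on a Borel subset of $X$, if $\mathcal Q$ is the smallest equivalence relation on $X$ containing all the $\mathcal E_j$ and if, for all $n\ge 2$, all points $x_1,\dots,x_n$ of $X$ with $x_n=x_1$ and all $j_1,\dots,j_{n-1}\in J$ with $(x_k,x_{k+1})\in\mathcal E_{j_k}$ for $1\le k\le n-1$ and $j_k\ne j_{k+1}$ for $1\le k\le n-2$, there is $1\le k\le n-1$ with $x_k=x_{k+1}$. The *full pseudogroup* $[[\mathcal R]]$ is the set of Borel isomorphisms $\phi:A\to B$ between Borel subsets of $X$ such that $(x,\phi(x))\in\mathcal R$ for all $x\in A$. For such a $\phi$ and an equivalence relation $\mathcal E$ on $\phi(A)$, $\phi^{-1}\mathcal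 E\phi$ is the relation on $A$ in which $x,y$ are equivalent when $(\phi(x),\phi(y))\in\mathcal E$. A Borel equivalence relation on $X$ is *treeable* if there is a symmetric, irreflexive Borel subset of $X\times X$ which, seen as a graph on $X$, has no cycles and has the equivalence classes as its connected components. Let $\mathcal S\subseteq\mathcal R$ be a Borel equivalence relation on $X$. Then there are countable sets $K(i)$ ($i\in I$), elements $\phi_{i,k}$ of $[[\mathcal R]]$ ($i\in I$, $k\in K(i)$), defined on Borel subsets $A_{i,k}$ of $X$, and a treeable Borel equivalence relation $\mathcal T\subseteq\mathcal S$ on $X$ such that $$\mathcal S=\star_{i\in I}\bigl(\star_{k\in K(i)}\mathcal S_{i,k}\bigr)\star\mathcal T,\qquad \mathcal S_{i,k}=\bigl(\phi_{i,k}^{-1}\,\mathcal R_i|_{\phi_{i,k}(A_{i,k})}\,\phi_{i,k}\bigr)\cap\mathcal S,$$ that is, $\mathcal S$ is the free product of the countable family consisting of all the $\mathcal S_{i,k}$ ($i\in I$, $k\in K(i)$) together with $\mathcal T$. Moreover, for every $i\in I$ there is $k\in K(i)$ such that $A_{i,k}=X$ and $\mathcal S_{i,k}=\mathcal R_i\cap\mathcal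 S$. -/

import Mathlib

/-- A Borel equivalence relation: one whose graph is a measurable subset of `X × X`. -/
def IsBorelRel {X : Type*} [MeasurableSpace X] (E : Setoid X) : Prop :=
  MeasurableSet {p : X × X | E p.1 p.2}

/-- All equivalence classes of `E` are countable. -/
def HasCountableClasses {X : Type*} (E : Setoid X) : Prop :=
  ∀ x : X, {y : X | E x y}.Countable

/-- The full pseudogroup `[[R]]`: the Borel isomorphisms `φ : A → B` between Borel subsets
`A = φ.source` and `B = φ.target` of `X` whose graph is contained in `R`. -/
def fullPseudogroup {X : Type*} [MeasurableSpace X] (R : Setoid X) : Set (PartialEquiv X X) :=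
  {φ | MeasurableSet φ.source ∧ MeasurableSet φ.target ∧
    Measurable (fun x : φ.source => φ x) ∧ Measurable (fun y : φ.target => φ.symm y) ∧
    ∀ x ∈ φ.source, R x (φ x)}

/-- The restriction `E|_B` of a relation to a subset `B`, as a relation defined on `B`. -/
def restrictRel {X : Type*} (E : X → X → Prop) (B : Set X) (x y : X) : Prop :=
  x ∈ B ∧ y ∈ B ∧ E x y

/-- The conjugate `φ⁻¹ E φ`, a relation defined on the source of `φ`: two points `x, y` of the
source are related when `φ x` and `φ y` are `E`-related. -/
def conjRel {X : Type*} (φ : PartialEquiv X X) (E : X → X → Prop) (x y : X) : Prop :=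
  x ∈ φ.source ∧ y ∈ φ.source ∧ E (φ x) (φ y)

/-- `R` is the free product of the family `E`. Each `E j` is meant to be an equivalence relation
on a subset of `X`. The family generates `R` as an equivalence relation on `X`, and along every
closed path `x 0, x 1, …, x n = x 0` with `n ≥ 1` steps, the `k`-th step being an `E (c k)`-step
and consecutive indices `c k`, `c (k + 1)` being distinct, some step is trivial. -/
def IsFreeProduct {X : Type*} {J : Type*} (R : Setoid X) (E : J → X → X → Prop) : Prop :=
  (∀ x y : X, R x y ↔ Relation.EqvGen (fun a b => ∃ j, E j a b) x y) ∧
  ∀ (n : ℕ) (x : ℕ → X) (c : ℕ → J), 1 ≤ n →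
    (∀ k, k < n → E (c k) (x k) (x (k + 1))) →
    (∀ k, k + 1 < n → c k ≠ c (k + 1)) →
    x n = x 0 →
    ∃ k, k < n ∧ x k = x (k + 1)

/-- `E` is treeable: there is a Borel graph on `X` without cycles whose connected components are
exactly the classes of `E`, so that it makes each class a tree. -/
def IsTreeable {X : Type*} [MeasurableSpace X] (E : Setoid X) : Prop :=
  ∃ G : SimpleGraph X, MeasurableSet {p : X × X | G.Adj p.1 p.2} ∧ G.IsAcyclic ∧
    ∀ x y : X, E x y ↔ G.Reachable x y

/-- The relation `(φ⁻¹ E|_{φ(A)} φ) ∩ S`, where `A` is the source of `φ`. -/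
def kuroshFactor {X : Type*} (E S : Setoid X) (φ : PartialEquiv X X) (x y : X) : Prop :=
  conjRel φ (restrictRel E (φ '' φ.source)) x y ∧ S x y

/-!
A family `E j` generating an equivalence relation is a free product exactly when arbitrary
functions `f j` with integer values can be glued by a potential `u`, in the sense that
`u x - u y = f j x - f j y` whenever `x` and `y` are `E j`-related. Given such a gluing for the
`R_i`, one transfers it to the factors of `S` instead of reducing words.

By Lusin–Novikov and Feldman–Moore, the classes of `R` are enumerated by countably many Borel
automorphisms, so that all choices below are Borel. Fix a class of `S` and let the height of a
point of the ambient `R`-class be its distance to this `S`-class, in steps of the `R_i`. A point of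
positive height is not lowest in some `R_i`-class; moving it to a lowest point of this class, its
parent, and iterating leads to its root, a point of the `S`-class. The `R_i`-relation between points
of least rank becomes, after passing to roots, the relation `S_{i,k}`, where `k` indexes an
automorphism carrying the root back to the point. Each point `y` also has in its `R_i`-class a base
of least rank, and joining the root of `y` to the root of its base gives the graph that
generates `T`.

Potentials for the `R_i` that are constant along parents descend to the `S`-class. On the points of
least rank of an `R_i`-class they can be prescribed freely, which handles `S_{i,k}`, and so can
their variation between a point and its base, which handles the edges. The same potentials show
that the graph is acyclic.
-/

open Set Filter Topology MeasureTheory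
open scoped ENNReal Function

section GraphUnion

variable {X Y : Type*} [MeasurableSpace X] [MeasurableSpace Y]

/-- `C` is a countable union of Borel graphs of partial functions from `X` to `Y`, such a graph
being a set on which the first projection is injective. -/
def IsGraphUnion (C : Set (X × Y)) : Prop :=
  ∃ 𝒢 : Set (Set (X × Y)), 𝒢.Countable ∧ (∀ G ∈ 𝒢, MeasurableSet G ∧ InjOn Prod.fst G) ∧ C = ⋃₀ 𝒢

theorem IsGraphUnion.measurableSet {C : Set (X × Y)} (hC : IsGraphUnion C) : MeasurableSet C := by
  obtain ⟨𝒢, h𝒢, hG, rfl⟩ := hC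
  exact .sUnion h𝒢 fun G hGm => (hG G hGm).1

theorem IsGraphUnion.of_injOn {G : Set (X × Y)} (hG : MeasurableSet G) (hinj : InjOn Prod.fst G) :
    IsGraphUnion G :=
  ⟨{G}, countable_singleton G, by simp [hG, hinj], by simp⟩

theorem IsGraphUnion.iUnion {ι : Type*} [Countable ι] {C : ι → Set (X × Y)}
    (hC : ∀ i, IsGraphUnion (C i)) : IsGraphUnion (⋃ i, C i) := by
  choose 𝒢 h𝒢 hG hC using hC
  refine ⟨⋃ i, 𝒢 i, countable_iUnion h𝒢, fun G hGm => ?_, ?_⟩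
  · obtain ⟨i, hi⟩ := mem_iUnion.1 hGm
    exact hG i G hi
  · simp only [hC, sUnion_iUnion]

theorem IsGraphUnion.empty : IsGraphUnion (∅ : Set (X × Y)) :=
  .of_injOn .empty (injOn_empty _)

theorem IsGraphUnion.union {C D : Set (X × Y)} (hC : IsGraphUnion C) (hD : IsGraphUnion D) :
    IsGraphUnion (C ∪ D) := by
  rw [union_eq_iUnion]
  exact .iUnion fun b => by cases b <;> assumption

theorem IsGraphUnion.inter {C P : Set (X × Y)} (hC : IsGraphUnion C) (hP : MeasurableSet P) :
    IsGraphUnion (C ∩ P) := by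
  obtain ⟨𝒢, h𝒢, hG, rfl⟩ := hC
  refine ⟨(· ∩ P) '' 𝒢, h𝒢.image _, ?_, by rw [sUnion_image, sUnion_eq_biUnion, iUnion₂_inter]⟩
  rintro _ ⟨G, hGm, rfl⟩
  exact ⟨(hG G hGm).1.inter hP, (hG G hGm).2.mono inter_subset_left⟩

end GraphUnion

section AnalyticGraph

theorem analyticSet_inter {X : Type*} [TopologicalSpace X] [T2Space X] {A B : Set X}
    (hA : AnalyticSet A) (hB : AnalyticSet B) : AnalyticSet (A ∩ B) := by
  rw [inter_eq_iInter]
  exact .iInter fun b => by cases b <;> assumption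

variable {X Y : Type*}
  [TopologicalSpace X] [PolishSpace X] [MeasurableSpace X] [BorelSpace X]
  [TopologicalSpace Y] [PolishSpace Y] [MeasurableSpace Y] [BorelSpace Y] {G : Set (X × Y)}

theorem exists_measurableSet_fst_mem_iff_snd_mem (hG : AnalyticSet G) (hinj : InjOn Prod.fst G)
    {U : Set Y} (hU : MeasurableSet U) :
    ∃ W : Set X, MeasurableSet W ∧ ∀ p ∈ G, p.1 ∈ W ↔ p.2 ∈ U := by
  have analytic {V : Set Y} (hV : MeasurableSet V) :
      AnalyticSet (Prod.fst '' (G ∩ Prod.snd ⁻¹' V)) :=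
    (analyticSet_inter hG (measurable_snd hV).analyticSet).image_of_continuous continuous_fst
  have disj : Disjoint (Prod.fst '' (G ∩ Prod.snd ⁻¹' U)) (Prod.fst '' (G ∩ Prod.snd ⁻¹' Uᶜ)) := by
    rw [Set.disjoint_left]
    rintro _ ⟨p, ⟨hp, hpU⟩, rfl⟩ ⟨q, ⟨hq, hqU⟩, hqp⟩
    obtain rfl := hinj hq hp hqp
    exact hqU hpU
  obtain ⟨W, hUW, hWU, hW⟩ := (analytic hU).measurablySeparable (analytic hU.compl) disj
  refine ⟨W, hW, fun p hp => ⟨fun h => ?_, fun h => hUW ⟨p, ⟨hp, h⟩, rfl⟩⟩⟩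
  by_contra hpU
  exact Set.disjoint_left.1 hWU ⟨p, ⟨hp, hpU⟩, rfl⟩ h

theorem exists_measurableSet_injOn_fst_superset (hG : AnalyticSet G) (hinj : InjOn Prod.fst G) :
    ∃ G', G ⊆ G' ∧ MeasurableSet G' ∧ InjOn Prod.fst G' := by
  let 𝔅 := TopologicalSpace.countableBasis Y
  have meas : ∀ U ∈ 𝔅, MeasurableSet U := fun U hU =>
    (TopologicalSpace.isOpen_of_mem_countableBasis hU).measurableSet
  choose! W hW hWG using fun U hU => exists_measurableSet_fst_mem_iff_snd_mem hG hinj (meas U hU)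
  refine ⟨⋂ U ∈ 𝔅, {p | p.1 ∈ W U ↔ p.2 ∈ U},
    fun p hp => mem_iInter₂.2 fun U hU => hWG U hU p hp,
    .biInter (TopologicalSpace.countable_countableBasis Y) fun U hU =>
      (measurable_fst (hW U hU)).iff (measurable_snd (meas U hU)), ?_⟩
  rintro ⟨x, y⟩ hy ⟨x', y'⟩ hy' (rfl : x = x')
  by_contra! hne
  obtain ⟨U, hU, hyU, hUs⟩ :=
    (TopologicalSpace.isBasis_countableBasis Y).exists_subset_of_mem_open
      (show y ∈ {y'}ᶜ from fun h : y = y' => hne (by rw [h])) isOpen_compl_singleton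
  exact hUs ((mem_iInter₂.1 hy' U hU).1 ((mem_iInter₂.1 hy U hU).2 hyU)) rfl

end AnalyticGraph

section Thin

variable {X Y Z : Type*} {F : Z → X × Y} {C : Set (X × Y)} {𝒰 : Set (Set Z)}

/-- The points `x` such that, for every `U ∈ 𝒰`, the image `F '' U` meets the vertical section at
`x` outside `C`. -/
def commonSections (F : Z → X × Y) (C : Set (X × Y)) (𝒰 : Set (Set Z)) : Set X :=
  {x | ∀ U ∈ 𝒰, ∃ z ∈ U, (F z).1 = x ∧ F z ∉ C}

theorem commonSections_anti {D : Set (X × Y)} (h : C ⊆ D) :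
    commonSections F D 𝒰 ⊆ commonSections F C 𝒰 := fun _ hx U hU =>
  let ⟨z, hz, hzx, hzD⟩ := hx U hU
  ⟨z, hz, hzx, fun hzC => hzD (h hzC)⟩

theorem analyticSet_commonSections [TopologicalSpace X] [PolishSpace X] [TopologicalSpace Z]
    [PolishSpace Z] [MeasurableSpace Z] [BorelSpace Z] (hF : Continuous fun z => (F z).1)
    (hC : MeasurableSet (F ⁻¹' C)) (hne : 𝒰.Nonempty) (hc : 𝒰.Countable)
    (h𝒰 : ∀ U ∈ 𝒰, MeasurableSet U) : AnalyticSet (commonSections F C 𝒰) := by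
  have : Nonempty 𝒰 := hne.to_subtype
  have : Countable 𝒰 := hc.to_subtype
  have analytic (U : 𝒰) : AnalyticSet ((fun z => (F z).1) '' (U \ F ⁻¹' C)) :=
    ((h𝒰 U U.2).diff hC).analyticSet.image_of_continuous hF
  convert! AnalyticSet.iInter analytic
  ext x
  simp [commonSections, and_assoc, and_comm (a := (F _).1 = x)]

variable [MeasurableSpace X] [MeasurableSpace Y]

/-- A family `𝒰` is thin along `F` if removing a countable union of Borel graphs makes its set of
common sections empty. If the range of `F` is not such a union, then non-thin families can be
refined forever, which yields a vertical section containing a copy of the Cantor set. -/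
def IsThin (F : Z → X × Y) (𝒰 : Set (Set Z)) : Prop :=
  ∃ C, IsGraphUnion C ∧ commonSections F C 𝒰 = ∅

theorem nonempty_commonSections_of_not_isThin (h : ¬ IsThin F 𝒰) :
    (commonSections F ∅ 𝒰).Nonempty :=
  nonempty_iff_ne_empty.2 fun he => h ⟨∅, .empty, he⟩

theorem exists_isGraphUnion_forall_isThin {𝔅 : Set (Set Z)} (h𝔅 : 𝔅.Countable) :
    ∃ C, IsGraphUnion C ∧ ∀ 𝒰 : Set (Set Z), 𝒰.Finite → 𝒰 ⊆ 𝔅 → IsThin F 𝒰 →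
      commonSections F C 𝒰 = ∅ := by
  let 𝒯 := {𝒰 | (𝒰.Finite ∧ 𝒰 ⊆ 𝔅) ∧ IsThin F 𝒰}
  have : Countable 𝒯 := ((countable_ofPred_finite_subset h𝔅).mono fun _ h => h.1).to_subtype
  choose C hC hCe using fun 𝒰 : 𝒯 => 𝒰.2.2
  refine ⟨⋃ 𝒰, C 𝒰, .iUnion hC, fun 𝒰 hfin hsub hthin => ?_⟩
  have h := commonSections_anti (F := F) (𝒰 := 𝒰) (subset_iUnion C ⟨𝒰, ⟨hfin, hsub⟩, hthin⟩)
  rwa [hCe, subset_empty_iff] at h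

theorem isGraphUnion_range_of_forall_isThin {𝔅 : Set (Set Z)} (h𝔅 : 𝔅.Countable)
    (hcov : ⋃₀ 𝔅 = univ) (hthin : ∀ U ∈ 𝔅, IsThin F {U}) (hF : MeasurableSet (range F)) :
    IsGraphUnion (range F) := by
  obtain ⟨C, hC, hCe⟩ := exists_isGraphUnion_forall_isThin (F := F) h𝔅
  have range_subset : range F ⊆ C := by
    rintro _ ⟨z, rfl⟩
    obtain ⟨U, hU, hzU⟩ := mem_sUnion.1 (hcov.symm ▸ mem_univ z)
    by_contra hzC
    have empty := hCe {U} (finite_singleton U) (singleton_subset_iff.2 hU) (hthin U hU)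
    refine eq_empty_iff_forall_notMem.1 empty (F z).1 ?_
    rintro _ rfl
    exact ⟨z, hzU, rfl, hzC⟩
  rw [← inter_eq_right.2 range_subset]
  exact hC.inter hF

theorem isThin_insert_of_subset {s : Set Z} (hC : IsGraphUnion C) {G : Set (X × Y)}
    (hG : IsGraphUnion G)
    (hsub : (F '' s \ C) ∩ Prod.fst ⁻¹' commonSections F C (insert s 𝒰) ⊆ G) :
    IsThin F (insert s 𝒰) := by
  refine ⟨C ∪ G, hC.union hG, eq_empty_of_forall_notMem fun x hx => ?_⟩
  obtain ⟨z, hz, rfl, hzCG⟩ := hx s (mem_insert s 𝒰)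
  exact hzCG (.inr (hsub ⟨⟨⟨z, hz, rfl⟩, fun hzC => hzCG (.inl hzC)⟩,
    commonSections_anti subset_union_left hx⟩))

end Thin

section Splitting

variable {X Y Z : Type*} {F : Z → X × Y} {s : Set Z} {ε : ℝ≥0∞} {𝔅 : Set (Set Z)}

/-- The two sets `t b` are small, their closures lie in `s`, and the images of the `t b` under `F`
have disjoint projections to `Y`. -/
structure IsSplitting [PseudoEMetricSpace Z] (F : Z → X × Y) (ε : ℝ≥0∞) (s : Set Z)
    (t : Bool → Set Z) : Prop where
  closure_subset : ∀ b, closure (t b) ⊆ s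
  ediam_le : ∀ b, Metric.ediam (t b) ≤ ε
  disjoint : Pairwise (Disjoint on fun b => (fun z => (F z).2) '' t b)

theorem exists_mem_basis_closure_subset_ediam_le [PseudoEMetricSpace Z]
    (h𝔅 : TopologicalSpace.IsTopologicalBasis 𝔅) {U : Set Z} (hU : IsOpen U) (hε : 0 < ε)
    {z : Z} (hz : z ∈ U) : ∃ t ∈ 𝔅, z ∈ t ∧ closure t ⊆ U ∧ Metric.ediam t ≤ ε := by
  obtain ⟨δ, hδ, hδε⟩ := exists_between (ENNReal.half_pos hε.ne')
  obtain ⟨t, ht, hzt, htU⟩ := h𝔅.exists_closure_subset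
    (inter_mem (hU.mem_nhds hz) (Metric.eball_mem_nhds z hδ))
  refine ⟨t, ht, hzt, htU.trans inter_subset_left, ?_⟩
  calc Metric.ediam t ≤ Metric.ediam (Metric.eball z δ) :=
        Metric.ediam_mono (subset_closure.trans (htU.trans inter_subset_right))
    _ ≤ 2 * δ := Metric.ediam_eball_le
    _ ≤ 2 * (ε / 2) := by gcongr
    _ = ε := ENNReal.mul_div_cancel two_ne_zero ENNReal.ofNat_ne_top

theorem exists_isSplitting_of_ne [PseudoEMetricSpace Z] [TopologicalSpace Y] [T2Space Y]
    (hF : Continuous fun z => (F z).2) (h𝔅 : TopologicalSpace.IsTopologicalBasis 𝔅) (hs : IsOpen s)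
    (hε : 0 < ε) {z : Bool → Z} (hz : ∀ b, z b ∈ s) (hne : (F (z false)).2 ≠ (F (z true)).2) :
    ∃ t : Bool → Set Z, IsSplitting F ε s t ∧ ∀ b, t b ∈ 𝔅 ∧ z b ∈ t b := by
  obtain ⟨V, W, hV, hW, hzV, hzW, hVW⟩ := t2_separation hne
  let N : Bool → Set Y := fun b => bif b then W else V
  have hN : ∀ b, IsOpen (N b) := by rintro (_ | _) <;> assumption
  have hzN : ∀ b, (F (z b)).2 ∈ N b := by rintro (_ | _) <;> assumption
  have disj : Pairwise (Disjoint on N) := by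
    rintro (_ | _) (_ | _) h
    exacts [(h rfl).elim, hVW, hVW.symm, (h rfl).elim]
  choose t ht hzt hts htε using fun b => exists_mem_basis_closure_subset_ediam_le h𝔅
    (hs.inter ((hN b).preimage hF)) hε ⟨hz b, hzN b⟩
  refine ⟨t, ⟨fun b => (hts b).trans inter_subset_left, htε, fun b b' hb => ?_⟩,
    fun b => ⟨ht b, hzt b⟩⟩
  have image_subset b : (fun z => (F z).2) '' t b ⊆ N b :=
    image_subset_iff.2 (subset_closure.trans ((hts b).trans inter_subset_right))
  exact (disj hb).mono (image_subset b) (image_subset b')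

variable [TopologicalSpace X] [PolishSpace X] [MeasurableSpace X] [BorelSpace X]
  [TopologicalSpace Y] [PolishSpace Y] [MeasurableSpace Y] [BorelSpace Y]
  [EMetricSpace Z] [PolishSpace Z]

theorem exists_isSplitting_not_isThin (hF : Continuous F)
    (h𝔅 : TopologicalSpace.IsTopologicalBasis 𝔅) (hc : 𝔅.Countable)
    (hs : s ∈ 𝔅) {𝒰 : Set (Set Z)} (hfin : 𝒰.Finite) (hsub : 𝒰 ⊆ 𝔅) (hε : 0 < ε)
    (h : ¬ IsThin F (insert s 𝒰)) :
    ∃ t, IsSplitting F ε s t ∧ (∀ b, t b ∈ 𝔅) ∧ ¬ IsThin F (range t ∪ 𝒰) := by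
  contrapose! h
  obtain ⟨C, hC, hCe⟩ := exists_isGraphUnion_forall_isThin (F := F) hc
  let _ : MeasurableSpace Z := borel Z
  have : BorelSpace Z := ⟨rfl⟩
  have meas : ∀ U ∈ 𝔅, MeasurableSet U := fun U hU => (h𝔅.isOpen hU).measurableSet
  have hFC : MeasurableSet (F ⁻¹' C) := hF.measurable hC.measurableSet
  let G : Set (X × Y) := (F '' s \ C) ∩ Prod.fst ⁻¹' commonSections F C (insert s 𝒰)
  have hG : AnalyticSet G := by
    refine analyticSet_inter ?_ ((analyticSet_commonSections (continuous_fst.comp hF) hFC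
      (insert_nonempty s 𝒰) (hfin.insert s).countable fun U hU =>
        meas U (insert_subset hs hsub hU)).preimage continuous_fst)
    rw [← image_sdiff_preimage]
    exact ((meas s hs).diff hFC).analyticSet.image_of_continuous hF
  have hGinj : InjOn Prod.fst G := by
    rintro _ ⟨⟨⟨z, hz, rfl⟩, hzC⟩, hzA⟩ _ ⟨⟨⟨z', hz', rfl⟩, hzC'⟩, -⟩ hzz'
    by_contra hne
    obtain ⟨t, hst, ht⟩ := exists_isSplitting_of_ne (z := fun b => bif b then z' else z)
      (continuous_snd.comp hF) h𝔅 (h𝔅.isOpen hs) hε (by rintro (_ | _) <;> assumption)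
      fun h => hne (Prod.ext hzz' h)
    have empty := hCe (range t ∪ 𝒰) ((finite_range t).union hfin)
      (union_subset (range_subset_iff.2 fun b => (ht b).1) hsub) (h t hst fun b => (ht b).1)
    refine eq_empty_iff_forall_notMem.1 empty (F z).1 ?_
    rintro U (⟨_ | _, rfl⟩ | hU)
    exacts [⟨z, (ht false).2, rfl, hzC⟩, ⟨z', (ht true).2, hzz'.symm, hzC'⟩,
      hzA U (mem_insert_of_mem s hU)]
  obtain ⟨G', hGG', hG', hG'inj⟩ := exists_measurableSet_injOn_fst_superset hG hGinj
  exact isThin_insert_of_subset hC (.of_injOn hG' hG'inj) hGG'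

theorem exists_forall_isSplitting_not_isThin (hF : Continuous F)
    (h𝔅 : TopologicalSpace.IsTopologicalBasis 𝔅) (hc : 𝔅.Countable) (hε : 0 < ε)
    {𝒰 : Set (Set Z)} (h𝒰fin : 𝒰.Finite) (h𝒰 : 𝒰 ⊆ 𝔅) {𝒲 : Set (Set Z)} (h𝒲fin : 𝒲.Finite)
    (h𝒲 : 𝒲 ⊆ 𝔅) (h : ¬ IsThin F (𝒰 ∪ 𝒲)) :
    ∃ σ : Set Z → Bool → Set Z, (∀ s ∈ 𝒰, IsSplitting F ε s (σ s) ∧ ∀ b, σ s b ∈ 𝔅) ∧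
      ¬ IsThin F ((⋃ s ∈ 𝒰, range (σ s)) ∪ 𝒲) := by
  induction 𝒰, h𝒰fin using Set.Finite.induction_on generalizing 𝒲 with
  | empty => exact ⟨fun _ _ => ∅, by simp, by simpa using h⟩
  | @insert s 𝒰 hs h𝒰fin ih =>
    rw [insert_union] at h
    obtain ⟨hs𝔅, h𝒰⟩ := insert_subset_iff.1 h𝒰
    obtain ⟨t, hst, ht, hthin⟩ := exists_isSplitting_not_isThin hF h𝔅 hc hs𝔅
      (h𝒰fin.union h𝒲fin) (union_subset h𝒰 h𝒲) hε h
    obtain ⟨σ, hσ, hσthin⟩ := ih h𝒰 ((finite_range t).union h𝒲fin)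
      (union_subset (range_subset_iff.2 ht) h𝒲) (by rwa [union_left_comm])
    have update_of_mem : ∀ u ∈ 𝒰, Function.update σ s t u = σ u := fun u hu =>
      Function.update_of_ne (ne_of_mem_of_not_mem hu hs) t σ
    refine ⟨Function.update σ s t, ?_, ?_⟩
    · rintro u (rfl | hu)
      · rw [Function.update_self]
        exact ⟨hst, ht⟩
      · rw [update_of_mem u hu]
        exact hσ u hu
    · rwa [biUnion_insert, Function.update_self,
        iUnion₂_congr fun u hu => congrArg range (update_of_mem u hu), union_assoc,
        union_left_comm]

end Splitting

section Scheme

variable {X Y Z : Type*} {F : Z → X × Y}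

/-- `D` is a scheme of successive splittings along `F`, with diameters tending to `0`, such that on
every level the images of all the sets of that level meet a common vertical section. -/
structure IsSplittingScheme [PseudoEMetricSpace Z] (F : Z → X × Y) (D : List Bool → Set Z) :
    Prop where
  isSplitting : ∀ l, IsSplitting F (l.length + 1 : ℝ≥0∞)⁻¹ (D l) fun b => D (b :: l)
  exists_fst_eq : ∀ n, ∃ x, ∀ l : List Bool, l.length = n → ∃ z ∈ D l, (F z).1 = x

theorem IsSplittingScheme.ediam_le [PseudoEMetricSpace Z] {D : List Bool → Set Z}
    (hD : IsSplittingScheme F D) : ∀ l, Metric.ediam (D l) ≤ (l.length : ℝ≥0∞)⁻¹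
  | [] => by simp
  | b :: l => by simpa using (hD.isSplitting l).ediam_le b

theorem IsSplittingScheme.vanishingDiam [PseudoMetricSpace Z] {D : List Bool → Set Z}
    (hD : IsSplittingScheme F D) : CantorScheme.VanishingDiam D := fun x =>
  tendsto_of_tendsto_of_tendsto_of_le_of_le tendsto_const_nhds
    ENNReal.tendsto_inv_nat_nhds_zero (fun _ => zero_le) fun n => by
      simpa using hD.ediam_le (PiNat.res x n)

theorem IsSplittingScheme.exists_not_countable_section [TopologicalSpace X] [T2Space X]
    [MetricSpace Z] [CompleteSpace Z] (hF : Continuous fun z => (F z).1) {D : List Bool → Set Z}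
    (hD : IsSplittingScheme F D) : ∃ x, ¬ {y | (x, y) ∈ range F}.Countable := by
  choose x hx using hD.exists_fst_eq
  have nonempty l : (D l).Nonempty := (hx l.length l rfl).imp fun _ h => h.1
  have dom := CantorScheme.ClosureAntitone.map_of_vanishingDiam hD.vanishingDiam
    (fun l b => (hD.isSplitting l).closure_subset b) nonempty
  let z (b : ℕ → Bool) : Z := (CantorScheme.inducedMap D).2 ⟨b, dom ▸ mem_univ b⟩
  have hz b n : z b ∈ D (PiNat.res b n) := CantorScheme.map_mem _ n
  have tendsto_fst b : Tendsto x atTop (𝓝 (F (z b)).1) := by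
    choose w hw hwx using fun n => hx n (PiNat.res b n) (PiNat.res_length b n)
    have : Tendsto w atTop (𝓝 (z b)) := by
      rw [tendsto_iff_edist_tendsto_0]
      exact tendsto_of_tendsto_of_tendsto_of_le_of_le tendsto_const_nhds (hD.vanishingDiam b)
        (fun _ => zero_le) fun n => Metric.edist_le_ediam_of_mem (hw n) (hz b n)
    exact ((hF.tendsto _).comp this).congr hwx
  have injective_snd : Function.Injective fun b => (F (z b)).2 := by
    intro b b' hbb'
    refine PiNat.res_injective (funext fun n => ?_)
    induction n with
    | zero => rfl
    | succ n ih =>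
      rw [PiNat.res_succ, PiNat.res_succ, ih]
      congr 1
      by_contra hne
      refine Set.disjoint_left.1 ((hD.isSplitting (PiNat.res b' n)).disjoint hne)
        ⟨z b, ?_, rfl⟩ ⟨z b', ?_, hbb'.symm⟩
      · simpa [ih] using hz b (n + 1)
      · simpa using hz b' (n + 1)
  let x₀ := (F (z fun _ => false)).1
  have uncountable : Uncountable (ℕ → Bool) :=
    Cardinal.aleph0_lt_mk_iff.1 (by simpa using Cardinal.cantor Cardinal.aleph0)
  refine ⟨x₀, fun hc => not_countable (α := ℕ → Bool) ?_⟩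
  have maps b : (F (z b)).2 ∈ {y | (x₀, y) ∈ range F} :=
    ⟨z b, Prod.ext (tendsto_nhds_unique (tendsto_fst b) (tendsto_fst _)) rfl⟩
  have : Countable {y | (x₀, y) ∈ range F} := hc.to_subtype
  exact (injective_snd.codRestrict maps).countable

variable [TopologicalSpace X] [PolishSpace X] [MeasurableSpace X] [BorelSpace X]
  [TopologicalSpace Y] [PolishSpace Y] [MeasurableSpace Y] [BorelSpace Y]
  [EMetricSpace Z] [PolishSpace Z]

theorem exists_isSplittingScheme (hF : Continuous F) {𝔅 : Set (Set Z)}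
    (h𝔅 : TopologicalSpace.IsTopologicalBasis 𝔅) (hc : 𝔅.Countable) {U : Set Z} (hU : U ∈ 𝔅)
    (hthin : ¬ IsThin F {U}) : ∃ D, IsSplittingScheme F D := by
  let 𝒯 := {𝒰 : Set (Set Z) // 𝒰.Finite ∧ 𝒰 ⊆ 𝔅 ∧ ¬ IsThin F 𝒰}
  choose σ hσ hσthin using fun (n : ℕ) (𝒰 : 𝒯) =>
    exists_forall_isSplitting_not_isThin hF h𝔅 hc (ε := (n + 1 : ℝ≥0∞)⁻¹) (by simp) 𝒰.2.1 𝒰.2.2.1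
      finite_empty (empty_subset 𝔅) (by simpa using 𝒰.2.2.2)
  let next (n : ℕ) (𝒰 : 𝒯) : 𝒯 := ⟨⋃ s ∈ 𝒰.1, range (σ n 𝒰 s),
    𝒰.2.1.biUnion fun _ _ => finite_range _,
    iUnion₂_subset fun s hs => range_subset_iff.2 (hσ n 𝒰 s hs).2, by simpa using hσthin n 𝒰⟩
  let stage : ℕ → 𝒯 := Nat.rec
    ⟨{U}, finite_singleton U, singleton_subset_iff.2 hU, hthin⟩ next
  let D : List Bool → Set Z := List.rec U fun b l s => σ l.length (stage l.length) s b
  have hD : ∀ l, D l ∈ (stage l.length).1 := by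
    intro l
    induction l with
    | nil => rfl
    | cons b l ih => exact mem_biUnion ih (mem_range_self b)
  refine ⟨D, fun l => (hσ _ _ _ (hD l)).1, fun n => ?_⟩
  obtain ⟨x, hx⟩ := nonempty_commonSections_of_not_isThin (stage n).2.2.2
  refine ⟨x, ?_⟩
  rintro l rfl
  obtain ⟨z, hz, hzx, -⟩ := hx (D l) (hD l)
  exact ⟨z, hz, hzx⟩

end Scheme

/-- The Lusin–Novikov theorem. -/
theorem isGraphUnion_of_countable_sections {X Y : Type*} [MeasurableSpace X] [StandardBorelSpace X]
    [MeasurableSpace Y] [StandardBorelSpace Y] {P : Set (X × Y)} (hP : MeasurableSet P)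
    (hc : ∀ x, {y | (x, y) ∈ P}.Countable) : IsGraphUnion P := by
  let _ := upgradeStandardBorel X
  let _ := upgradeStandardBorel Y
  obtain ⟨Z, _, _, F, hF, rfl⟩ := analyticSet_iff_exists_polishSpace_range.1 hP.analyticSet
  let _ := TopologicalSpace.upgradeIsCompletelyMetrizable Z
  have h𝔅 := TopologicalSpace.isBasis_countableBasis Z
  have h𝔅c := TopologicalSpace.countable_countableBasis Z
  by_contra hP'
  obtain ⟨U, hU, hthin⟩ : ∃ U ∈ TopologicalSpace.countableBasis Z, ¬ IsThin F {U} := by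
    contrapose! hP'
    exact isGraphUnion_range_of_forall_isThin h𝔅c h𝔅.sUnion_eq hP' hP
  obtain ⟨D, hD⟩ := exists_isSplittingScheme hF h𝔅 h𝔅c hU hthin
  obtain ⟨x, hx⟩ := hD.exists_not_countable_section (continuous_fst.comp hF)
  exact hx (hc x)

section FeldmanMoore

theorem exists_measurable_forall_mem_iff {X Y : Type*} [MeasurableSpace X] [StandardBorelSpace X]
    [MeasurableSpace Y] [StandardBorelSpace Y] {P : Set (X × Y)} (hP : MeasurableSet P)
    (hex : ∀ x, ∃! y, (x, y) ∈ P) : ∃ f : X → Y, Measurable f ∧ ∀ x y, (x, y) ∈ P ↔ f x = y := by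
  choose f hf hunique using hex
  have mem_iff x y : (x, y) ∈ P ↔ f x = y := ⟨fun h => (hunique x y h).symm, fun h => h ▸ hf x⟩
  have injOn : InjOn Prod.fst P := by
    rintro ⟨x, y⟩ h ⟨x', y'⟩ h' (rfl : x = x')
    rw [← (mem_iff x y).1 h, ← (mem_iff x y').1 h']
  refine ⟨f, fun U hU => ?_, mem_iff⟩
  convert! (hP.inter (measurable_snd hU)).image_of_measurable_injOn measurable_fst
    (injOn.mono inter_subset_left)
  ext x
  simp [mem_iff]

variable {X : Type*} [MeasurableSpace X] [StandardBorelSpace X]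

theorem exists_measurableEquiv_of_symmetric_graph {K : Set (X × X)} (hK : MeasurableSet K)
    (hinj : InjOn Prod.fst K) (hsymm : ∀ x y, (x, y) ∈ K → (y, x) ∈ K) :
    ∃ g : X ≃ᵐ X, (∀ x y, (x, y) ∈ K → g x = y) ∧ ∀ x, (x, g x) ∈ K ∨ g x = x := by
  let P : Set (X × X) := K ∪ diagonal X ∩ Prod.fst ⁻¹' (Prod.fst '' K)ᶜ
  have hP : MeasurableSet P := hK.union (measurableSet_diagonal.inter
    (measurable_fst (hK.image_of_measurable_injOn measurable_fst hinj).compl))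
  have existsUnique x : ∃! y, (x, y) ∈ P := by
    by_cases hx : x ∈ Prod.fst '' K
    · obtain ⟨⟨x, y⟩, hxy, rfl⟩ := hx
      refine ⟨y, .inl hxy, ?_⟩
      rintro y' (h | ⟨-, h⟩)
      exacts [congrArg Prod.snd (hinj h hxy rfl), (h ⟨_, hxy, rfl⟩).elim]
    · refine ⟨x, .inr ⟨rfl, hx⟩, ?_⟩
      rintro y (h | ⟨h, -⟩)
      exacts [(hx ⟨_, h, rfl⟩).elim, Eq.symm h]
  obtain ⟨g, hg, hgP⟩ := exists_measurable_forall_mem_iff hP existsUnique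
  have involutive : Function.Involutive g := fun x => by
    rw [← hgP]
    rcases (hgP x _).2 rfl with h | ⟨h : x = g x, hx⟩
    · exact .inl (hsymm _ _ h)
    · rw [← h]
      exact .inr ⟨rfl, hx⟩
  refine ⟨⟨involutive.toPerm, hg, hg⟩, fun x y h => (hgP x y).1 (.inl h), fun x => ?_⟩
  exact ((hgP x _).2 rfl).imp id fun h => Eq.symm h.1

theorem exists_measurableEquiv_swapping {G G' : Set (X × X)} {U : Set X} (hG : MeasurableSet G)
    (hGinj : InjOn Prod.fst G) (hG' : MeasurableSet G') (hG'inj : InjOn Prod.fst G')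
    (hU : MeasurableSet U) :
    ∃ g : X ≃ᵐ X,
      (∀ x ∈ U, ∀ y ∉ U, (x, y) ∈ G → (y, x) ∈ G' → g x = y ∧ g y = x) ∧
      ∀ x, (x, g x) ∈ G ∨ (g x, x) ∈ G ∨ g x = x := by
  let H : Set (X × X) := (G ∩ Prod.swap ⁻¹' G') ∩ U ×ˢ Uᶜ
  have hH : MeasurableSet H := (hG.inter (measurable_swap hG')).inter (hU.prod hU.compl)
  have injOn : InjOn Prod.fst (H ∪ Prod.swap ⁻¹' H) := by
    rintro ⟨x, y⟩ hp ⟨x', z⟩ hq (rfl : x = x')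
    rcases hp with ⟨⟨hy, -⟩, hx, -⟩ | ⟨⟨-, hy⟩, -, hx⟩ <;>
      rcases hq with ⟨⟨hz, -⟩, hx', -⟩ | ⟨⟨-, hz⟩, -, hx'⟩
    exacts [hGinj hy hz rfl, (hx' hx).elim, (hx hx').elim, hG'inj hy hz rfl]
  obtain ⟨g, hg, hgH⟩ := exists_measurableEquiv_of_symmetric_graph
    (hH.union (measurable_swap hH)) injOn fun _ _ => Or.symm
  refine ⟨g, fun x hx y hy hxy hyx => ?_, fun x => ?_⟩
  · have hp : (x, y) ∈ H := ⟨⟨hxy, hyx⟩, hx, hy⟩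
    exact ⟨hg x y (.inl hp), hg y x (.inr hp)⟩
  · rcases hgH x with (h | h) | h
    exacts [.inl h.1.1, .inr (.inl h.1.1), .inr (.inr h)]

theorem exists_countable_forall_rel_iff_exists_measurableEquiv {R : Setoid X} (hR : IsBorelRel R)
    (hRc : HasCountableClasses R) :
    ∃ 𝒜 : Set (X ≃ᵐ X), 𝒜.Countable ∧ ∀ x y, R x y ↔ x = y ∨ ∃ g ∈ 𝒜, g x = y := by
  obtain ⟨𝒢, h𝒢, hG, hcov⟩ := isGraphUnion_of_countable_sections
    (P := {p : X × X | R p.1 p.2}) hR hRc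
  have mem_iff x y : R x y ↔ ∃ G ∈ 𝒢, (x, y) ∈ G := Set.ext_iff.1 hcov (x, y)
  obtain ⟨U, hU, hsep⟩ := exists_seq_separating X MeasurableSet.empty univ
  have : Countable 𝒢 := h𝒢.to_subtype
  choose g hgswap hgmem using fun i : 𝒢 × 𝒢 × ℕ => exists_measurableEquiv_swapping
    (hG i.1 i.1.2).1 (hG i.1 i.1.2).2 (hG i.2.1 i.2.1.2).1 (hG i.2.1 i.2.1.2).2 (hU i.2.2)
  have rel i x : R x (g i x) := by
    rcases hgmem i x with h | h | h
    · exact (mem_iff _ _).2 ⟨_, i.1.2, h⟩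
    · exact R.symm ((mem_iff _ _).2 ⟨_, i.1.2, h⟩)
    · rw [h]
  have exists_swap {x y n} (hx : x ∈ U n) (hy : y ∉ U n) (hxy : R x y) :
      ∃ i, g i x = y ∧ g i y = x := by
    obtain ⟨G, hG, h⟩ := (mem_iff x y).1 hxy
    obtain ⟨G', hG', h'⟩ := (mem_iff y x).1 (R.symm hxy)
    exact ⟨_, hgswap (⟨G, hG⟩, ⟨G', hG'⟩, n) x hx y hy h h'⟩
  refine ⟨range g, countable_range g, fun x y => ⟨fun hxy => or_iff_not_imp_left.2 fun hne => ?_,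
    ?_⟩⟩
  · rw [exists_range_iff]
    obtain ⟨n, hn⟩ : ∃ n, ¬ (x ∈ U n ↔ y ∈ U n) :=
      not_forall.1 fun h => hne (hsep x (mem_univ x) y (mem_univ y) h)
    rcases (xor_iff_not_iff _ _).2 hn with ⟨hx, hy⟩ | ⟨hy, hx⟩
    · exact (exists_swap hx hy hxy).imp fun _ => And.left
    · exact (exists_swap hy hx (R.symm hxy)).imp fun _ => And.right
  · rintro (rfl | ⟨_, ⟨i, rfl⟩, rfl⟩)
    exacts [R.refl x, rel i x]

/-- A sequence of Borel automorphisms whose orbits at each point enumerate its class. -/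
structure ClassEnumeration {X : Type*} [MeasurableSpace X] (R : Setoid X) where
  /-- The automorphisms of the sequence. -/
  map : ℕ → X ≃ᵐ X
  map_zero : map 0 = .refl X
  rel_iff : ∀ {x y}, R x y ↔ ∃ n, map n x = y

/-- The Feldman–Moore theorem. -/
theorem nonempty_classEnumeration {R : Setoid X} (hR : IsBorelRel R)
    (hRc : HasCountableClasses R) : Nonempty (ClassEnumeration R) := by
  obtain ⟨𝒜, h𝒜, hrel⟩ := exists_countable_forall_rel_iff_exists_measurableEquiv hR hRc
  obtain ⟨f, hf⟩ := (h𝒜.insert (.refl X)).exists_eq_range (insert_nonempty _ _)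
  refine ⟨fun n => n.casesOn (.refl X) f, rfl, fun {x y} => ?_⟩
  have exists_mem_iff : (∃ g ∈ insert (.refl X) 𝒜, g x = y) ↔ ∃ n, f n x = y := by
    rw [hf, exists_range_iff]
  rw [hrel, ← Nat.or_exists_add_one, ← exists_mem_iff]
  simp

end FeldmanMoore

section ReducedPath

variable {X J : Type*} {n : ℕ} {p : ℕ → X} {c : ℕ → J}

/-- The points `p 0, …, p n` form a path whose steps are nontrivial, the `k`-th one being an
`E (c k)`-step, and whose consecutive indices are distinct. The values of `p` beyond `n` and of `c`
beyond `n - 1` play no role. -/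
structure IsReducedPath (E : J → X → X → Prop) (n : ℕ) (p : ℕ → X) (c : ℕ → J) : Prop where
  step : ∀ k < n, E (c k) (p k) (p (k + 1))
  index_ne : ∀ k, k + 1 < n → c k ≠ c (k + 1)
  ne : ∀ k < n, p k ≠ p (k + 1)

theorem isFreeProduct_iff {R : Setoid X} {E : J → X → X → Prop} :
    IsFreeProduct R E ↔ (∀ x y, R x y ↔ Relation.EqvGen (fun a b => ∃ j, E j a b) x y) ∧
      ∀ n p c, IsReducedPath E n p c → p n = p 0 → n = 0 := by
  refine and_congr_right fun _ => ⟨fun h n p c hp hclosed => ?_, fun h n p c hn hE hc hclosed => ?_⟩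
  · by_contra hn
    obtain ⟨k, hk, hk'⟩ := h n p c (Nat.one_le_iff_ne_zero.2 hn) hp.step hp.index_ne hclosed
    exact hp.ne k hk hk'
  · by_contra! hne
    exact Nat.one_le_iff_ne_zero.1 hn (h n p c ⟨hE, hc, hne⟩ hclosed)

theorem IsFreeProduct.factor_le {R : Setoid X} {E : J → Setoid X}
    (h : IsFreeProduct R fun j => E j) (j : J) : E j ≤ R :=
  fun x y hxy => (h.1 x y).2 (.rel _ _ ⟨j, hxy⟩)

theorem eqvGen_iff_reflTransGen_of_setoid {E : J → Setoid X} {x y : X} :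
    Relation.EqvGen (fun a b => ∃ j, E j a b) x y ↔
      Relation.ReflTransGen (fun a b => ∃ j, E j a b) x y := by
  have : Std.Symm fun a b => ∃ j, E j a b := ⟨fun _ _ => .imp fun j => (E j).symm⟩
  rw [Relation.EqvGen.eqvGen_eq_reflTransGen]

theorem IsFreeProduct.rel_iff_reflTransGen {R : Setoid X} {E : J → Setoid X}
    (h : IsFreeProduct R fun j => E j) {x y : X} :
    R x y ↔ Relation.ReflTransGen (fun a b => ∃ j, E j a b) x y :=
  (h.1 x y).trans eqvGen_iff_reflTransGen_of_setoid

theorem IsReducedPath.slice {E : J → X → X → Prop} (h : IsReducedPath E n p c) {a m : ℕ}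
    (ham : m + a ≤ n) : IsReducedPath E m (fun k => p (k + a)) fun k => c (k + a) where
  step k hk := by simpa only [add_right_comm] using h.step (k + a) (by omega)
  index_ne k hk := by simpa only [add_right_comm] using h.index_ne (k + a) (by omega)
  ne k hk := by simpa only [add_right_comm] using h.ne (k + a) (by omega)

theorem IsReducedPath.cons {E : J → X → X → Prop} (h : IsReducedPath E n p c) {j : J} {x : X}
    (hx : E j x (p 0)) (hne : x ≠ p 0) (hj : 0 < n → j ≠ c 0) :
    IsReducedPath E (n + 1) (fun k => k.casesOn x p) fun k => k.casesOn j c where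
  step := by
    rintro (_ | k) hk
    exacts [hx, h.step k (by omega)]
  index_ne := by
    rintro (_ | k) hk
    exacts [hj (by omega), h.index_ne k (by omega)]
  ne := by
    rintro (_ | k) hk
    exacts [hne, h.ne k (by omega)]

theorem IsReducedPath.exists_cons {E : J → Setoid X} (h : IsReducedPath (fun j => E j) n p c)
    {j : J} {x : X} (hx : E j x (p 0)) :
    ∃ n' p' c', IsReducedPath (fun j => E j) n' p' c' ∧ p' 0 = x ∧ p' n' = p n := by
  by_cases hne : x = p 0
  · exact ⟨n, p, c, h, hne.symm, rfl⟩
  by_cases hj : 0 < n → j ≠ c 0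
  · exact ⟨_, _, _, h.cons hx hne hj, rfl, rfl⟩
  push Not at hj
  obtain ⟨hn, rfl⟩ := hj
  obtain ⟨m, rfl⟩ := Nat.exists_eq_add_one_of_ne_zero hn.ne'
  have htail := h.slice le_rfl
  have hx1 : E (c 0) x (p 1) := (E (c 0)).trans hx (h.step 0 hn)
  by_cases hne1 : x = p 1
  · exact ⟨m, _, _, htail, hne1.symm, rfl⟩
  · exact ⟨_, _, _, htail.cons hx1 hne1 fun hm => h.index_ne 0 (by omega), rfl, rfl⟩

theorem exists_isReducedPath_of_eqvGen [Nonempty J] {E : J → Setoid X} {x y : X}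
    (h : Relation.EqvGen (fun a b => ∃ j, E j a b) x y) :
    ∃ n p c, IsReducedPath (fun j => E j) n p c ∧ p 0 = x ∧ p n = y := by
  rw [eqvGen_iff_reflTransGen_of_setoid] at h
  induction h using Relation.ReflTransGen.head_induction_on with
  | refl => exact ⟨0, fun _ => y, fun _ => Classical.arbitrary J, ⟨by simp, by simp, by simp⟩,
      rfl, rfl⟩
  | head hxz _ ih =>
    obtain ⟨j, hj⟩ := hxz
    obtain ⟨n, p, c, hp, rfl, rfl⟩ := ih
    exact hp.exists_cons hj

theorem IsReducedPath.potential_last_eq_add_one [DecidableEq J] [DecidableEq X]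
    {E : J → X → X → Prop} (h : IsReducedPath E n p c) (hn : 0 < n)
    (hne : ∀ k, 1 < k → k ≤ n → p k ≠ p 1) {u : X → ℤ}
    (hu : ∀ j x y, E j x y → u x - (Pi.single (c 0) (Pi.single (p 1) 1) : J → X → ℤ) j x =
      u y - (Pi.single (c 0) (Pi.single (p 1) 1) : J → X → ℤ) j y) :
    u (p n) = u (p 0) + 1 := by
  have step k (hk : k < n) := hu _ _ _ (h.step k hk)
  have eq_one : ∀ k, 1 ≤ k → k ≤ n → u (p k) = u (p 1) := by
    intro k hk hkn
    induction k, hk using Nat.le_induction with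
    | base => rfl
    | succ k hk ih =>
      rw [← ih (by omega)]
      rcases hk.eq_or_lt with rfl | hk
      · simpa [Pi.single_eq_of_ne (h.index_ne 0 (by omega)).symm] using (step 1 hkn).symm
      · have vanish {m} (hm : 1 < m) (hmn : m ≤ n) j :
            (Pi.single (c 0) (Pi.single (p 1) 1) : J → X → ℤ) j (p m) = 0 := by
          rcases eq_or_ne j (c 0) with rfl | hj
          · rw [Pi.single_eq_same, Pi.single_eq_of_ne (hne m hm hmn)]
          · simp [hj]
        simpa [vanish hk (Nat.le_of_succ_le hkn), vanish (hk.trans k.lt_succ_self) hkn]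
          using (step k hkn).symm
  have first := step 0 hn
  simp only [Pi.single_eq_same, Pi.single_eq_of_ne (h.ne 0 hn), zero_add] at first
  have last := eq_one n hn le_rfl
  omega

end ReducedPath

section Potential

variable {X J A : Type*} [AddCommGroup A]

/-- The skew product of `E` by the coboundary of `f`: the equivalence relation on `X × A` whose
classes lie over classes of `E` and are parallel to the graph of `f`. -/
def skewProduct (E : Setoid X) (f : X → A) : Setoid (X × A) :=
  E.comap Prod.fst ⊓ Setoid.ker fun p => p.2 - f p.1

theorem skewProduct_iff {E : Setoid X} {f : X → A} {p q : X × A} :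
    skewProduct E f p q ↔ E p.1 q.1 ∧ p.2 - f p.1 = q.2 - f q.1 :=
  Iff.rfl

/-- The equivalence relation on `X × A` generated by the skew products of the `E j` by the
coboundaries of the `f j`. -/
def skewProductJoin (E : J → Setoid X) (f : J → X → A) : Setoid (X × A) :=
  ⨆ j, skewProduct (E j) (f j)

theorem skewProductJoin_iff_eqvGen {E : J → Setoid X} {f : J → X → A} {p q : X × A} :
    skewProductJoin E f p q ↔
      Relation.EqvGen (fun p q => ∃ j, skewProduct (E j) (f j) p q) p q := by
  rw [skewProductJoin, iSup, Setoid.sSup_eq_eqvGen]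
  exact Iff.of_eq <| congrArg (fun r => Relation.EqvGen r p q) <| by ext; exact exists_range_iff

theorem IsFreeProduct.eq_of_skewProductJoin {R : Setoid X} {E : J → Setoid X}
    (hR : IsFreeProduct R fun j => E j) {f : J → X → A} {x : X} {a b : A}
    (h : skewProductJoin E f (x, a) (x, b)) : a = b := by
  cases isEmpty_or_nonempty J with
  | inl _ =>
    rw [skewProductJoin, iSup_of_empty] at h
    exact congrArg Prod.snd h
  | inr _ =>
    obtain ⟨n, p, c, hp, hp0, hpn⟩ :=
      exists_isReducedPath_of_eqvGen (skewProductJoin_iff_eqvGen.1 h)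
    have projection : IsReducedPath (fun j => E j) n (fun k => (p k).1) c :=
      ⟨fun k hk => (hp.step k hk).1, hp.index_ne, fun k hk heq => hp.ne k hk <| Prod.ext heq <| by
        simpa [heq] using (skewProduct_iff.1 (hp.step k hk)).2⟩
    obtain rfl := (isFreeProduct_iff.1 hR).2 n _ c projection (by simp [hp0, hpn])
    exact congrArg Prod.snd (hp0.symm.trans hpn)

theorem IsFreeProduct.exists_skewProductJoin {R : Setoid X} {E : J → Setoid X}
    (hR : IsFreeProduct R fun j => E j) (f : J → X → A) {x y : X} (hxy : R x y) (a : A) :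
    ∃ b, skewProductJoin E f (x, a) (y, b) := by
  rw [hR.rel_iff_reflTransGen] at hxy
  induction hxy with
  | refl => exact ⟨a, (skewProductJoin E f).refl _⟩
  | @tail y z _ hyz ih =>
    obtain ⟨b, hb⟩ := ih
    obtain ⟨j, hj⟩ := hyz
    have lift : skewProduct (E j) (f j) (y, b) (z, b - f j y + f j z) :=
      skewProduct_iff.2 ⟨hj, by simp⟩
    exact ⟨_, (skewProductJoin E f).trans hb (le_iSup (fun j => skewProduct (E j) (f j)) j lift)⟩

theorem IsFreeProduct.exists_potential {R : Setoid X} {E : J → Setoid X}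
    (hR : IsFreeProduct R fun j => E j) (f : J → X → A) :
    ∃ u : X → A, ∀ j x y, E j x y → u x - f j x = u y - f j y := by
  choose u hu using fun x =>
    hR.exists_skewProductJoin f (Quotient.mk_out (s := R) x) 0
  refine ⟨u, fun j x y hxy => ?_⟩
  have lift : skewProductJoin E f (x, u x) (y, u x - f j x + f j y) :=
    le_iSup (fun j => skewProduct (E j) (f j)) j (skewProduct_iff.2 ⟨hxy, by simp⟩)
  have hy := hu y
  rw [← Quotient.sound (s := R) (hR.factor_le j hxy)] at hy
  rw [hR.eq_of_skewProductJoin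
    ((skewProductJoin E f).trans ((skewProductJoin E f).symm hy)
      ((skewProductJoin E f).trans (hu x) lift))]
  simp

theorem IsFreeProduct.of_exists_potential {S : Setoid X} {E : J → X → X → Prop}
    (hgen : ∀ x y, S x y ↔ Relation.EqvGen (fun a b => ∃ j, E j a b) x y)
    (hpot : ∀ f : J → X → ℤ, ∃ u : X → ℤ, ∀ j x y, E j x y → u x - f j x = u y - f j y) :
    IsFreeProduct S E := by
  classical
  refine isFreeProduct_iff.2 ⟨hgen, fun n => ?_⟩
  induction n using Nat.strong_induction_on with | _ n minimal => ?_
  intro p c hp hclosed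
  by_contra hn
  -- Along a shortest closed reduced path, a potential of the indicator function of the end of the
  -- first step rises there by one and never changes afterwards.
  obtain ⟨u, hu⟩ := hpot (Pi.single (c 0) (Pi.single (p 1) 1))
  have ne_one k (hk : 1 < k) (hkn : k ≤ n) : p k ≠ p 1 := by
    intro heq
    have := minimal (k - 1) (by omega) _ _ (hp.slice (a := 1) (by omega))
      (by simpa [Nat.sub_add_cancel hk.le] using heq)
    omega
  have := hp.potential_last_eq_add_one (Nat.pos_of_ne_zero hn) ne_one hu
  rw [hclosed] at this
  omega

theorem isAcyclic_of_exists_potential {G : SimpleGraph X}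
    (hpot : ∀ c : X → X → ℤ, (∀ x y, c y x = -c x y) →
      ∃ u : X → ℤ, ∀ x y, G.Adj x y → u x - u y = c x y) : G.IsAcyclic := by
  classical
  rw [SimpleGraph.isAcyclic_iff_forall_adj_isBridge]
  intro v w hvw
  rw [SimpleGraph.isBridge_iff]
  intro hreach
  obtain ⟨u, hu⟩ := hpot (fun x y => (if x = v ∧ y = w then 1 else 0) -
    (if x = w ∧ y = v then 1 else 0)) fun x y => by simp only [and_comm, neg_sub]
  have const {z} (hz : (G \ SimpleGraph.fromEdgeSet {s(v, w)}).Reachable v z) : u z = u v := by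
    rw [SimpleGraph.reachable_iff_reflTransGen] at hz
    induction hz with
    | refl => rfl
    | @tail y z _ hyz ih =>
      rw [SimpleGraph.sdiff_adj, SimpleGraph.fromEdgeSet_adj] at hyz
      have hne : ¬ ((y = v ∧ z = w) ∨ (y = w ∧ z = v)) := fun h =>
        hyz.2 ⟨Sym2.eq_iff.2 h, hyz.1.ne⟩
      have huyz := hu y z hyz.1
      rw [not_or] at hne
      rw [if_neg hne.1, if_neg hne.2] at huyz
      omega
  have huvw := hu v w hvw
  simp [const hreach, hvw.ne] at huvw

end Potential

section Descent

variable {X I α : Type*}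

/-- `y` minimizes `d` on its `E`-class. -/
def IsLowest [LE α] (E : Setoid X) (d : X → α) (y : X) : Prop :=
  ∀ y', E y y' → d y ≤ d y'

theorem exists_isLowest [LinearOrder α] [WellFoundedLT α] (E : Setoid X) (d : X → α) (y : X) :
    ∃ y', E y y' ∧ IsLowest E d y' := by
  obtain ⟨y', hy', hmin⟩ := exists_minimalFor_of_wellFoundedLT (E y) d ⟨y, E.refl y⟩
  exact ⟨y', hy', fun z hz => not_lt.1 fun hlt => (hmin (E.trans hy' hz) hlt.le).not_gt hlt⟩

theorem isLowest_of_height_eq_zero {E : Setoid X} {d : X → ℕ} {y : X} (h : d y = 0) :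
    IsLowest E d y :=
  fun _ _ => h ▸ Nat.zero_le _

namespace ClassEnumeration

variable [MeasurableSpace X] {R : Setoid X} (e : ClassEnumeration R)

theorem rel_map (n : ℕ) (x : X) : R x (e.map n x) :=
  e.rel_iff.2 ⟨n, rfl⟩

section First

variable {P Q : X → Prop} {y : X}

/-- The first point satisfying `P` in the enumeration of the class of `y`, and `y` itself if there
is none. -/
noncomputable def first (P : X → Prop) (y : X) : X :=
  e.map (sInf {m | P (e.map m y)}) y

theorem rel_first (P : X → Prop) (y : X) : R y (e.first P y) :=
  e.rel_map _ _

theorem first_spec (h : ∃ z, R y z ∧ P z) : P (e.first P y) := by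
  obtain ⟨z, hz, hP⟩ := h
  obtain ⟨m, rfl⟩ := e.rel_iff.1 hz
  exact Nat.sInf_mem (s := {m | P (e.map m y)}) ⟨m, hP⟩

theorem first_eq_self (h : P y) : e.first P y = y := by
  rw [first, Nat.sInf_eq_zero.2 (.inl (by simpa [e.map_zero] using h)), e.map_zero]
  rfl

theorem first_eq_self_of_forall_not (h : ∀ z, ¬P z) : e.first P y = y := by
  simp [first, h, e.map_zero]

theorem first_eq_first_of_imp (hPQ : ∀ z, P z → Q z) (h : P (e.first Q y)) :
    e.first P y = e.first Q y := by
  have : sInf {m | P (e.map m y)} = sInf {m | Q (e.map m y)} :=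
    le_antisymm (Nat.sInf_le h) <|
      Nat.sInf_le <| hPQ _ <| Nat.sInf_mem (s := {m | P (e.map m y)}) ⟨_, h⟩
  rw [first, first, this]

end First

section ToLowest

variable [LinearOrder α] {E : Setoid X} {d : X → α} {y : X}

/-- The first point minimizing `d` on the `E`-class of `y`. -/
noncomputable def toLowest (E : Setoid X) (d : X → α) (y : X) : X :=
  e.first (fun z => E y z ∧ IsLowest E d z) y

theorem toLowest_spec [WellFoundedLT α] (hE : E ≤ R) (d : X → α) (y : X) :
    E y (e.toLowest E d y) ∧ IsLowest E d (e.toLowest E d y) :=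
  e.first_spec <| (exists_isLowest E d y).imp fun _ hz => ⟨hE hz.1, hz⟩

theorem toLowest_eq_self (h : IsLowest E d y) : e.toLowest E d y = y :=
  e.first_eq_self ⟨E.refl y, h⟩

end ToLowest

variable {E : I → Setoid X} {d : X → ℕ} {y : X}

/-- The first point that is lowest in an `E i`-class in which `y` is not, and `y` itself if it is
lowest in all its `E i`-classes. -/
noncomputable def parent (E : I → Setoid X) (d : X → ℕ) (y : X) : X :=
  e.first (fun z => ∃ i, E i y z ∧ IsLowest (E i) d z ∧ ¬IsLowest (E i) d y) y

theorem rel_parent (y : X) : R y (e.parent E d y) :=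
  e.rel_first _ y

theorem parent_eq_self (h : ∀ i, IsLowest (E i) d y) : e.parent E d y = y :=
  e.first_eq_self_of_forall_not fun _ ⟨i, _, _, hi⟩ => hi (h i)

theorem exists_parent_eq_toLowest (hE : ∀ i, E i ≤ R) (h : ∃ i, ¬IsLowest (E i) d y) :
    ∃ i, e.parent E d y = e.toLowest (E i) d y ∧ ¬IsLowest (E i) d y := by
  obtain ⟨j, hj⟩ := h
  obtain ⟨z, hz, hzlow⟩ := exists_isLowest (E j) d y
  obtain ⟨i, hrel, hlow, hi⟩ : ∃ i, E i y (e.parent E d y) ∧ IsLowest (E i) d (e.parent E d y) ∧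
      ¬IsLowest (E i) d y :=
    e.first_spec (P := fun z => ∃ i, E i y z ∧ IsLowest (E i) d z ∧ ¬IsLowest (E i) d y)
      ⟨z, hE j hz, j, hz, hzlow, hj⟩
  exact ⟨i, (e.first_eq_first_of_imp (fun z hz => ⟨i, hz.1, hz.2, hi⟩) ⟨hrel, hlow⟩).symm, hi⟩

theorem height_parent_lt (hE : ∀ i, E i ≤ R) (h : ∃ i, ¬IsLowest (E i) d y) :
    d (e.parent E d y) < d y := by
  obtain ⟨i, heq, hi⟩ := e.exists_parent_eq_toLowest hE h
  obtain ⟨hrel, hlow⟩ := e.toLowest_spec (hE i) d y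
  rw [heq]
  by_contra! hle
  exact hi fun z hz => hle.trans (hlow z ((E i).trans ((E i).symm hrel) hz))

/-- The last of the successive parents of `y`. Parents strictly decrease the height `d` as long as
there are any, so `d y` steps suffice. -/
noncomputable def root (E : I → Setoid X) (d : X → ℕ) (y : X) : X :=
  (e.parent E d)^[d y] y

theorem apply_root_eq {β : Type*} {u : X → β} (hu : ∀ y, u (e.parent E d y) = u y) (y : X) :
    u (e.root E d y) = u y := by
  have h : Function.Semiconj u (e.parent E d) id := hu
  exact (h.iterate_right (d y) y).trans (by rw [Function.iterate_id, id])

theorem rel_root (y : X) : R y (e.root E d y) :=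
  Quotient.exact <| Eq.symm <|
    e.apply_root_eq (u := Quotient.mk R) (fun y => Quotient.sound (R.symm (e.rel_parent y))) y

theorem root_eq_self (h : d y = 0) : e.root E d y = y := by
  rw [root, h, Function.iterate_zero_apply]

section

variable (hE : ∀ i, E i ≤ R) (hd : ∀ y, 0 < d y → ∃ i, ¬IsLowest (E i) d y)
include hE hd

theorem height_iterate_parent_eq_zero {n : ℕ} (hn : d y ≤ n) :
    d ((e.parent E d)^[n] y) = 0 := by
  induction n generalizing y with
  | zero => exact Nat.le_zero.1 hn
  | succ n ih =>
    rw [Function.iterate_succ_apply]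
    refine ih ?_
    obtain h0 | hpos := (d y).eq_zero_or_pos
    · rw [e.parent_eq_self fun _ => isLowest_of_height_eq_zero h0, h0]
      exact n.zero_le
    · exact Nat.lt_succ_iff.1 ((e.height_parent_lt hE (hd y hpos)).trans_le hn)

theorem height_root (y : X) : d (e.root E d y) = 0 :=
  e.height_iterate_parent_eq_zero hE hd le_rfl

theorem root_parent (y : X) : e.root E d (e.parent E d y) = e.root E d y := by
  by_cases h : ∀ i, IsLowest (E i) d y
  · rw [e.parent_eq_self h]
  push Not at h
  obtain ⟨m, hm⟩ := Nat.exists_eq_add_of_lt (e.height_parent_lt hE h)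
  have iterate : e.root E d y = (e.parent E d)^[m] (e.root E d (e.parent E d y)) := by
    rw [root, root, ← Function.iterate_add_apply, ← Function.iterate_succ_apply, hm]
    congr 1
    omega
  rw [iterate, Function.iterate_fixed]
  exact e.parent_eq_self fun _ => isLowest_of_height_eq_zero (e.height_root hE hd _)

end

/-- The first index of an automorphism leading from the root of `y` to `y`. -/
noncomputable def rootIndex (E : I → Setoid X) (d : X → ℕ) (y : X) : ℕ :=
  sInf {n | e.map n (e.root E d y) = y}

theorem map_rootIndex_root (y : X) : e.map (e.rootIndex E d y) (e.root E d y) = y :=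
  Nat.sInf_mem (s := {n | e.map n (e.root E d y) = y}) (e.rel_iff.1 (R.symm (e.rel_root y)))

theorem rootIndex_eq_zero (h : d y = 0) : e.rootIndex E d y = 0 :=
  Nat.sInf_eq_zero.2 (.inl (by simp [e.root_eq_self h, e.map_zero]))

/-- The height refined by the root index: among the points of an `E i`-class, those of least rank
are those of least height that have the least root index. -/
noncomputable def rank (E : I → Setoid X) (d : X → ℕ) (y : X) : ℕ ×ₗ ℕ :=
  toLex (d y, e.rootIndex E d y)

theorem isLowest_of_isLowest_rank {F : Setoid X} (h : IsLowest F (e.rank E d) y) :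
    IsLowest F d y :=
  fun z hz => (Prod.Lex.le_iff.1 (h z hz)).elim le_of_lt fun h => h.1.le

theorem isLowest_rank_of_height_eq_zero {F : Setoid X} (h : d y = 0) :
    IsLowest F (e.rank E d) y := fun z _ => by
  simp [rank, Prod.Lex.le_iff, h, e.rootIndex_eq_zero, Nat.eq_zero_or_pos, or_comm, eq_comm]

theorem rootIndex_eq_of_isLowest_rank {F : Setoid X} {z : X} (hyz : F y z)
    (hy : IsLowest F (e.rank E d) y) (hz : IsLowest F (e.rank E d) z) :
    e.rootIndex E d y = e.rootIndex E d z :=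
  congrArg (fun p => (ofLex p).2) (le_antisymm (hy z hyz) (hz y (F.symm hyz)))

/-- A point of least rank in the `E i`-class of `y`, chosen in such a way that `y` and the first
lowest point of this class get the same one. -/
noncomputable def base (E : I → Setoid X) (d : X → ℕ) (i : I) (y : X) : X :=
  e.toLowest (E i) (e.rank E d) (e.toLowest (E i) d y)

theorem base_spec {i : I} (hE : E i ≤ R) (y : X) :
    E i y (e.base E d i y) ∧ IsLowest (E i) (e.rank E d) (e.base E d i y) :=
  ⟨(E i).trans (e.toLowest_spec hE d y).1 (e.toLowest_spec hE (e.rank E d) _).1,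
    (e.toLowest_spec hE (e.rank E d) _).2⟩

theorem base_eq_self {i : I} (h : IsLowest (E i) (e.rank E d) y) : e.base E d i y = y := by
  rw [base, e.toLowest_eq_self (e.isLowest_of_isLowest_rank h), e.toLowest_eq_self h]

theorem base_toLowest {i : I} (hE : E i ≤ R) (y : X) :
    e.base E d i (e.toLowest (E i) d y) = e.base E d i y := by
  rw [base, base, e.toLowest_eq_self (e.toLowest_spec hE d y).2]

theorem exists_root_potential {A : Type*} [AddCommGroup A] (hfree : IsFreeProduct R fun i => E i)
    (hd : ∀ y, 0 < d y → ∃ i, ¬IsLowest (E i) d y) (F : I → ℕ → X → A) {c : X → X → A}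
    (hc : ∀ x, c x x = 0) :
    ∃ u : X → A,
      (∀ i y z, E i y z → IsLowest (E i) (e.rank E d) y → IsLowest (E i) (e.rank E d) z →
        u (e.root E d y) - F i (e.rootIndex E d y) (e.root E d y) =
          u (e.root E d z) - F i (e.rootIndex E d z) (e.root E d z)) ∧
      ∀ i y, u (e.root E d y) - u (e.root E d (e.base E d i y)) =
        c (e.root E d y) (e.root E d (e.base E d i y)) := by
  have hE := hfree.factor_le
  let r := e.root E d
  let g i y := F i (e.rootIndex E d y) (r y)
  -- On a point of least rank, the second term vanishes and the first one is the prescribed one.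
  let f i y := g i (e.base E d i y) + c (r y) (r (e.base E d i y))
  have f_of_isLowest {i y} (h : IsLowest (E i) (e.rank E d) y) : f i y = g i y := by
    simp only [f, e.base_eq_self h, hc, add_zero]
  obtain ⟨u, hu⟩ := hfree.exists_potential f
  have u_parent y : u (e.parent E d y) = u y := by
    by_cases h : ∀ i, IsLowest (E i) d y
    · rw [e.parent_eq_self h]
    push Not at h
    obtain ⟨i, heq, -⟩ := e.exists_parent_eq_toLowest hE h
    have f_parent : f i (e.parent E d y) = f i y := by
      simp only [f, r, e.root_parent hE hd]
      rw [heq, e.base_toLowest (hE i)]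
    have := hu i y (e.parent E d y) (heq ▸ (e.toLowest_spec (hE i) d y).1)
    rw [f_parent] at this
    exact (sub_left_inj.1 this).symm
  have u_root y : u (r y) = u y := e.apply_root_eq u_parent y
  refine ⟨u, fun i y z hyz hy hz => ?_, fun i y => ?_⟩
  · have := hu i y z hyz
    rwa [f_of_isLowest hy, f_of_isLowest hz, ← u_root y, ← u_root z] at this
  · obtain ⟨hrel, hlow⟩ := e.base_spec (d := d) (hE i) y
    have := hu i y _ hrel
    rw [f_of_isLowest hlow, ← u_root y, ← u_root (e.base E d i y)] at this
    rw [sub_eq_sub_iff_sub_eq_sub] at this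
    simpa [f] using this

end ClassEnumeration

end Descent

section StepDistance

variable {X : Type*}

/-- `y` is joined to a point satisfying `P` by a path of exactly `n` successive `r`-steps. -/
def ReachesIn (r : X → X → Prop) (P : X → Prop) : ℕ → X → Prop
  | 0, y => P y
  | n + 1, y => ∃ z, r y z ∧ ReachesIn r P n z

/-- The length of a shortest `r`-path from `y` to a point satisfying `P`. It is zero if there is no
such path. -/
noncomputable def stepDist (r : X → X → Prop) (P : X → Prop) (y : X) : ℕ :=
  sInf {n | ReachesIn r P n y}

variable {r : X → X → Prop} {P : X → Prop} {y z : X}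

theorem exists_reachesIn_iff :
    (∃ n, ReachesIn r P n y) ↔ ∃ z, Relation.ReflTransGen r y z ∧ P z := by
  constructor
  · rintro ⟨n, hn⟩
    induction n generalizing y with
    | zero => exact ⟨y, .refl, hn⟩
    | succ n ih =>
      obtain ⟨x, hyx, hx⟩ := hn
      obtain ⟨z, hxz, hz⟩ := ih hx
      exact ⟨z, .head hyx hxz, hz⟩
  · rintro ⟨z, hyz, hz⟩
    induction hyz using Relation.ReflTransGen.head_induction_on with
    | refl => exact ⟨0, hz⟩
    | head hyx _ ih =>
      obtain ⟨n, hn⟩ := ih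
      exact ⟨n + 1, _, hyx, hn⟩

theorem stepDist_eq_zero (h : P y) : stepDist r P y = 0 :=
  Nat.sInf_eq_zero.2 (.inl h)

theorem of_stepDist_eq_zero (hyz : Relation.ReflTransGen r y z) (hz : P z)
    (h : stepDist r P y = 0) : P y := by
  have : ReachesIn r P (stepDist r P y) y := Nat.sInf_mem (exists_reachesIn_iff.2 ⟨z, hyz, hz⟩)
  rwa [h] at this

theorem exists_stepDist_lt (h : 0 < stepDist r P y) :
    ∃ z, r y z ∧ stepDist r P z < stepDist r P y := by
  have : ReachesIn r P (stepDist r P y) y := Nat.sInf_mem (Nat.nonempty_of_pos_sInf h)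
  obtain ⟨n, hn⟩ := Nat.exists_eq_add_one_of_ne_zero h.ne'
  rw [hn] at this ⊢
  obtain ⟨z, hyz, hz⟩ := this
  exact ⟨z, hyz, Nat.lt_succ_of_le (Nat.sInf_le hz)⟩

end StepDistance

section ClassDistance

variable {X I : Type*} {E : I → Setoid X} {S : Setoid X} {a b y : X}

/-- The number of steps in the relations `E i` from `y` to the `S`-class of `a`. -/
noncomputable def classDist (E : I → Setoid X) (S : Setoid X) (a : X) : X → ℕ :=
  stepDist (fun y z => ∃ i, E i y z) (S a)

theorem classDist_congr (h : S a b) : classDist E S a = classDist E S b := by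
  have : ⇑S a = S b := funext fun y => propext ⟨S.trans (S.symm h), S.trans h⟩
  rw [classDist, classDist, this]

theorem classDist_eq_zero (h : S a y) : classDist E S a y = 0 :=
  stepDist_eq_zero h

theorem rel_of_classDist_eq_zero {R : Setoid X} (hfree : IsFreeProduct R fun i => E i)
    (hay : R a y) (h : classDist E S a y = 0) : S a y :=
  of_stepDist_eq_zero (hfree.rel_iff_reflTransGen.1 (R.symm hay)) (S.refl a) h

theorem exists_not_isLowest_of_classDist_pos (a y : X) (h : 0 < classDist E S a y) :
    ∃ i, ¬IsLowest (E i) (classDist E S a) y := by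
  obtain ⟨z, ⟨i, hyz⟩, hlt⟩ := exists_stepDist_lt h
  exact ⟨i, fun hlow => (hlow z hyz).not_gt hlt⟩

end ClassDistance

section Kurosh

namespace ClassEnumeration

variable {X I : Type*} [MeasurableSpace X] {R : Setoid X} (e : ClassEnumeration R)
  {E : I → Setoid X} {S : Setoid X} {x x' : X}

/-- The points `x` that are the root, for the distance to their `S`-class, of the point
`y = e.map k x`, where moreover `k` is the root index of `y` and `y` has least rank in its
`E i`-class. -/
def kuroshDom (E : I → Setoid X) (S : Setoid X) (i : I) (k : ℕ) : Set X :=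
  {x | e.root E (classDist E S x) (e.map k x) = x ∧
    e.rootIndex E (classDist E S x) (e.map k x) = k ∧
    IsLowest (E i) (e.rank E (classDist E S x)) (e.map k x)}

/-- The partial isomorphisms `φ_{i,k}` of the decomposition. -/
noncomputable def kuroshMap (E : I → Setoid X) (S : Setoid X) (i : I) (k : ℕ) :
    PartialEquiv X X :=
  (e.map k).toEquiv.toPartialEquivOfImageEq (e.kuroshDom E S i k) _ rfl

/-- The point `x'` is the root of the base of a point of root `x`, for the distance to the `S`-class
of `x`. -/
def RootEdge (E : I → Setoid X) (S : Setoid X) (x x' : X) : Prop :=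
  ∃ i y, e.root E (classDist E S x) y = x ∧
    e.root E (classDist E S x) (e.base E (classDist E S x) i y) = x'

/-- The graph of the root edges, whose components are the classes of the treeable factor. -/
def rootGraph (E : I → Setoid X) (S : Setoid X) : SimpleGraph X :=
  SimpleGraph.fromRel (e.RootEdge E S)

theorem kuroshFactor_kuroshMap_iff {i : I} {k : ℕ} :
    kuroshFactor (E i) S (e.kuroshMap E S i k) x x' ↔
      x ∈ e.kuroshDom E S i k ∧ x' ∈ e.kuroshDom E S i k ∧
        E i (e.map k x) (e.map k x') ∧ S x x' :=
  ⟨fun ⟨⟨hx, hx', _, _, hE⟩, hS⟩ => ⟨hx, hx', hE, hS⟩, fun ⟨hx, hx', hE, hS⟩ =>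
    ⟨⟨hx, hx', mem_image_of_mem _ hx, mem_image_of_mem _ hx', hE⟩, hS⟩⟩

theorem kuroshDom_zero (i : I) : e.kuroshDom E S i 0 = univ := by
  refine eq_univ_of_forall fun x => ?_
  have h : classDist E S x x = 0 := classDist_eq_zero (S.refl x)
  simp only [kuroshDom, mem_ofPred_eq, e.map_zero]
  exact ⟨e.root_eq_self h, e.rootIndex_eq_zero h, e.isLowest_rank_of_height_eq_zero h⟩

section

variable (hfree : IsFreeProduct R fun i => E i)
include hfree

theorem rel_root_classDist {a y : X} (hay : R a y) : S a (e.root E (classDist E S a) y) :=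
  rel_of_classDist_eq_zero hfree (R.trans hay (e.rel_root y)) <|
    e.height_root hfree.factor_le (exists_not_isLowest_of_classDist_pos a) y

theorem rootEdge_le (h : e.RootEdge E S x x') : S x x' := by
  obtain ⟨i, y, hx, rfl⟩ := h
  have hxy : R x y := by simpa only [hx] using R.symm (e.rel_root (E := E) (d := classDist E S x) y)
  have hE := hfree.factor_le i
  exact e.rel_root_classDist hfree (R.trans hxy (hE (e.base_spec hE y).1))

theorem rel_of_rootGraph_adj (h : (e.rootGraph E S).Adj x x') : S x x' :=
  h.2.elim (e.rootEdge_le hfree) fun h => S.symm (e.rootEdge_le hfree h)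

theorem reachableSetoid_rootGraph_le : (e.rootGraph E S).reachableSetoid ≤ S := by
  intro x x' h
  replace h := (SimpleGraph.reachable_iff_reflTransGen x x').1 h
  induction h with
  | refl => exact S.refl x
  | tail _ h ih => exact S.trans ih (e.rel_of_rootGraph_adj hfree h)

theorem exists_kurosh_potential_on_class (a : X) (F : I → ℕ → X → ℤ) {c : X → X → ℤ}
    (hc : ∀ x x', c x' x = -c x x') :
    ∃ u : X → ℤ, (∀ i k x x', S a x → kuroshFactor (E i) S (e.kuroshMap E S i k) x x' →
        u x - F i k x = u x' - F i k x') ∧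
      ∀ x x', S a x → (e.rootGraph E S).Adj x x' → u x - u x' = c x x' := by
  obtain ⟨u, hbase, hroot⟩ := e.exists_root_potential hfree
    (exists_not_isLowest_of_classDist_pos (S := S) a) F (c := c) fun x => by have := hc x x; omega
  refine ⟨u, fun i k x x' hax h => ?_, ?_⟩
  · obtain ⟨hx, hx', hE, hxx'⟩ := e.kuroshFactor_kuroshMap_iff.1 h
    obtain ⟨hr, hk, hlow⟩ := hx
    obtain ⟨hr', hk', hlow'⟩ := hx'
    rw [← classDist_congr hax] at hr hk hlow
    rw [← classDist_congr (S.trans hax hxx')] at hr' hk' hlow'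
    simpa only [hr, hk, hr', hk'] using hbase i _ _ hE hlow hlow'
  · have edge {x x'} (hax : S a x) (h : e.RootEdge E S x x') : u x - u x' = c x x' := by
      obtain ⟨i, y, hx, hx'⟩ := h
      rw [← classDist_congr hax] at hx hx'
      simpa only [hx, hx'] using hroot i y
    rintro x x' hax ⟨-, h | h⟩
    · exact edge hax h
    · rw [hc x' x, ← edge (S.trans hax (S.symm (e.rootEdge_le hfree h))) h, neg_sub]

theorem exists_kurosh_potential (F : I → ℕ → X → ℤ) {c : X → X → ℤ}
    (hc : ∀ x x', c x' x = -c x x') :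
    ∃ u : X → ℤ, (∀ i k x x', kuroshFactor (E i) S (e.kuroshMap E S i k) x x' →
        u x - F i k x = u x' - F i k x') ∧
      ∀ x x', (e.rootGraph E S).Adj x x' → u x - u x' = c x x' := by
  choose u hu using fun a => e.exists_kurosh_potential_on_class (S := S) hfree a F hc
  let o (x : X) : X := Quotient.out (Quotient.mk S x)
  have rel_o x : S (o x) x := Quotient.mk_out x
  have o_eq {x x'} (h : S x x') : o x = o x' := congrArg Quotient.out (Quotient.sound h)
  refine ⟨fun x => u (o x) x, fun i k x x' h => ?_, fun x x' h => ?_⟩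
  · simpa only [o_eq h.2] using (hu (o x)).1 i k x x' (rel_o x) h
  · simpa only [o_eq (e.rel_of_rootGraph_adj hfree h)] using (hu (o x)).2 x x' (rel_o x) h

theorem isAcyclic_rootGraph : (e.rootGraph E S).IsAcyclic :=
  isAcyclic_of_exists_potential fun _ hc =>
    (e.exists_kurosh_potential hfree (fun _ _ _ => 0) hc).imp fun _ => And.right

section Generation

variable {Q : Setoid X} {a y z : X}
  (hfactor : ∀ i k x x', kuroshFactor (E i) S (e.kuroshMap E S i k) x x' → Q x x')
  (hedge : ∀ x x', (e.rootGraph E S).Adj x x' → Q x x')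

include hedge in
theorem rel_root_base (hay : R a y) (i : I) :
    Q (e.root E (classDist E S a) y)
      (e.root E (classDist E S a) (e.base E (classDist E S a) i y)) := by
  have edge : e.RootEdge E S (e.root E (classDist E S a) y)
      (e.root E (classDist E S a) (e.base E (classDist E S a) i y)) := by
    have := classDist_congr (E := E) (e.rel_root_classDist (S := S) hfree hay)
    exact ⟨i, y, by rw [← this], by rw [← this]⟩
  by_cases heq : e.root E (classDist E S a) y =
      e.root E (classDist E S a) (e.base E (classDist E S a) i y)
  · rw [← heq]
  · exact hedge _ _ ⟨heq, .inl edge⟩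

theorem root_mem_kuroshDom {i : I} (hay : R a y)
    (hlow : IsLowest (E i) (e.rank E (classDist E S a)) y) :
    e.root E (classDist E S a) y ∈ e.kuroshDom E S i (e.rootIndex E (classDist E S a) y) := by
  simp only [kuroshDom, mem_ofPred_eq]
  rw [← classDist_congr (e.rel_root_classDist hfree hay), e.map_rootIndex_root]
  exact ⟨rfl, rfl, hlow⟩

include hfactor in
theorem rel_root_of_isLowest_rank {i : I} (hay : R a y) (hyz : E i y z)
    (hy : IsLowest (E i) (e.rank E (classDist E S a)) y)
    (hz : IsLowest (E i) (e.rank E (classDist E S a)) z) :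
    Q (e.root E (classDist E S a) y) (e.root E (classDist E S a) z) := by
  have haz := R.trans hay (hfree.factor_le i hyz)
  have hindex := e.rootIndex_eq_of_isLowest_rank hyz hy hz
  refine hfactor i (e.rootIndex E (classDist E S a) y) _ _ <|
    e.kuroshFactor_kuroshMap_iff.2 ⟨e.root_mem_kuroshDom hfree hay hy,
      hindex ▸ e.root_mem_kuroshDom hfree haz hz, ?_,
      S.trans (S.symm (e.rel_root_classDist hfree hay)) (e.rel_root_classDist hfree haz)⟩
  rw [e.map_rootIndex_root, hindex, e.map_rootIndex_root]
  exact hyz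

include hfactor hedge in
theorem rel_root_of_factor {i : I} (hay : R a y) (hyz : E i y z) :
    Q (e.root E (classDist E S a) y) (e.root E (classDist E S a) z) := by
  have hE := hfree.factor_le i
  have haz := R.trans hay (hE hyz)
  obtain ⟨hyb, hblow⟩ := e.base_spec (d := classDist E S a) hE y
  obtain ⟨hzb, hblow'⟩ := e.base_spec (d := classDist E S a) hE z
  have hbb := (E i).trans ((E i).symm hyb) ((E i).trans hyz hzb)
  exact Q.trans (e.rel_root_base hfree hedge hay i) <|
    Q.trans (e.rel_root_of_isLowest_rank hfree hfactor (R.trans hay (hE hyb)) hbb hblow hblow') <|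
      Q.symm (e.rel_root_base hfree hedge haz i)

include hfactor hedge in
theorem le_of_forall_kuroshFactor (hSR : S ≤ R) : S ≤ Q := by
  intro a b hab
  have rel_root {y} (hay : Relation.ReflTransGen (fun y z => ∃ i, E i y z) a y) :
      Q a (e.root E (classDist E S a) y) := by
    induction hay with
    | refl => rw [e.root_eq_self (classDist_eq_zero (S.refl a))]
    | tail hay hyz ih =>
      obtain ⟨i, hyz⟩ := hyz
      exact Q.trans ih <|
        e.rel_root_of_factor hfree hfactor hedge (hfree.rel_iff_reflTransGen.2 hay) hyz
  simpa only [e.root_eq_self (classDist_eq_zero hab)] using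
    rel_root (hfree.rel_iff_reflTransGen.1 (hSR hab))

end Generation

theorem isFreeProduct_kurosh (hSR : S ≤ R) : IsFreeProduct S
    (Sum.elim (fun p : (_ : I) × ℕ => kuroshFactor (E p.1) S (e.kuroshMap E S p.1 p.2))
      fun (_ : Unit) => (e.rootGraph E S).reachableSetoid) := by
  refine .of_exists_potential (fun x y => ⟨fun hxy => ?_, fun hxy => ?_⟩) fun f => ?_
  · exact e.le_of_forall_kuroshFactor (Q := Relation.EqvGen.setoid _) hfree
      (fun i k x x' h => .rel _ _ ⟨.inl ⟨i, k⟩, h⟩)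
      (fun x x' h => .rel _ _ ⟨.inr (), h.reachable⟩) hSR hxy
  · refine Setoid.eqvGen_le (s := S) ?_ hxy
    rintro x y ⟨_ | _, h⟩
    exacts [h.2, e.reachableSetoid_rootGraph_le hfree h]
  · let g := f (.inr ())
    obtain ⟨u, hfactor, hedge⟩ := e.exists_kurosh_potential (S := S) hfree
      (fun i k => f (.inl ⟨i, k⟩)) (c := fun x x' => g x - g x') fun x x' => by rw [neg_sub]
    refine ⟨u, ?_⟩
    rintro (⟨i, k⟩ | _) x y hxy
    · exact hfactor i k x y hxy
    · replace hxy := (SimpleGraph.reachable_iff_reflTransGen x y).1 hxy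
      induction hxy with
      | refl => rfl
      | tail _ h ih => exact ih.trans (sub_eq_sub_iff_sub_eq_sub.1 (hedge _ _ h))

end

end ClassEnumeration

end Kurosh

section Measurability

theorem IsBorelRel.measurable_comp {X Z : Type*} [MeasurableSpace X] [MeasurableSpace Z]
    {E : Setoid X} (hE : IsBorelRel E) {f g : Z → X} (hf : Measurable f) (hg : Measurable g) :
    Measurable fun z => E (f z) (g z) :=
  (measurableSet_setOfPred.1 hE).comp (hf.prodMk hg)

theorem measurable_nat_sInf {Z : Type*} [MeasurableSpace Z] {P : ℕ → Z → Prop}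
    (hP : ∀ n, Measurable (P n)) : Measurable fun z => sInf {n | P n z} := by
  refine measurable_to_countable' fun n => ?_
  have h : Measurable fun z => (P n z ∧ ∀ m < n, ¬P m z) ∨ (n = 0 ∧ ∀ m, ¬P m z) :=
    ((hP n).and (.forall fun m => .forall fun _ => (hP m).not)).or
      (measurable_const.and (.forall fun m => (hP m).not))
  convert! measurableSet_setOfPred.2 h using 1
  ext z
  simp only [mem_preimage, mem_singleton_iff, mem_ofPred_eq]
  constructor
  · rintro rfl
    obtain hempty | hne := eq_empty_or_nonempty {n | P n z}
    · exact .inr ⟨Nat.sInf_eq_zero.2 (.inr hempty), eq_empty_iff_forall_notMem.1 hempty⟩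
    · exact .inl ⟨Nat.sInf_mem hne, fun m hm => Nat.notMem_of_lt_sInf hm⟩
  · rintro (⟨hn, hlt⟩ | ⟨rfl, hnot⟩)
    · exact IsLeast.csInf_eq ⟨hn, fun m hm => not_lt.1 fun h => hlt m h hm⟩
    · exact Nat.sInf_eq_zero.2 (.inr (eq_empty_of_forall_notMem hnot))

theorem measurable_apply_le {X Z : Type*} [MeasurableSpace X] [MeasurableSpace Z] {d : Z → X → ℕ}
    (hd : Measurable fun p : Z × X => d p.1 p.2) :
    Measurable fun p : Z × X × X => d p.1 p.2.1 ≤ d p.1 p.2.2 :=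
  (hd.comp (measurable_fst.prodMk (measurable_fst.comp measurable_snd))).le'
    (hd.comp (measurable_fst.prodMk (measurable_snd.comp measurable_snd)))

namespace ClassEnumeration

variable {X I Z : Type*} [MeasurableSpace X] [MeasurableSpace Z] {R : Setoid X}
  (e : ClassEnumeration R)

theorem exists_iff_exists_map {x : X} {P : X → Prop} (hP : ∀ y, P y → R x y) :
    (∃ y, P y) ↔ ∃ m, P (e.map m x) := by
  refine ⟨fun ⟨y, hy⟩ => ?_, fun ⟨m, hm⟩ => ⟨_, hm⟩⟩
  obtain ⟨m, rfl⟩ := e.rel_iff.1 (hP y hy)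
  exact ⟨m, hy⟩

theorem measurable_map_comp {n : Z → ℕ} {g : Z → X} (hn : Measurable n) (hg : Measurable g) :
    Measurable fun z => e.map (n z) (g z) :=
  (measurable_from_prod_countable_right (f := fun p : ℕ × X => e.map p.1 p.2)
    fun m => (e.map m).measurable).comp (hn.prodMk hg)

theorem measurable_first {P : Z → X → Prop} (hP : Measurable fun p : Z × X => P p.1 p.2)
    {g : Z → X} (hg : Measurable g) : Measurable fun z => e.first (P z) (g z) :=
  e.measurable_map_comp
    (measurable_nat_sInf fun m => hP.comp (measurable_id.prodMk ((e.map m).measurable.comp hg))) hg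

include e in
theorem measurable_reachesIn {r : X → X → Prop} (hr : ∀ x y, r x y → R x y)
    (hrm : Measurable fun p : X × X => r p.1 p.2) {P : Z → X → Prop}
    (hP : Measurable fun p : Z × X => P p.1 p.2) (n : ℕ) :
    Measurable fun p : Z × X => ReachesIn r (P p.1) n p.2 := by
  induction n with
  | zero => exact hP
  | succ n ih =>
    have map_snd m : Measurable fun p : Z × X => e.map m p.2 :=
      (e.map m).measurable.comp measurable_snd
    simp only [ReachesIn, e.exists_iff_exists_map fun z (h : _ ∧ _) => hr _ z h.1]
    exact .exists fun m => (hrm.comp (measurable_snd.prodMk (map_snd m))).and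
      (ih.comp (measurable_fst.prodMk (map_snd m)))

section

variable {α : Type*} {E : Setoid X} {d : Z → X → α}

include e in
theorem measurable_isLowest [LE α] (hE : E ≤ R) (hEm : IsBorelRel E)
    (hd : Measurable fun p : Z × X × X => d p.1 p.2.1 ≤ d p.1 p.2.2) :
    Measurable fun p : Z × X => IsLowest E (d p.1) p.2 := by
  have map_snd m : Measurable fun p : Z × X => e.map m p.2 :=
    (e.map m).measurable.comp measurable_snd
  have isLowest_iff (p : Z × X) : IsLowest E (d p.1) p.2 ↔
      ∀ m, E p.2 (e.map m p.2) → d p.1 p.2 ≤ d p.1 (e.map m p.2) := by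
    refine ⟨fun h m => h _, fun h y hy => ?_⟩
    obtain ⟨m, rfl⟩ := e.rel_iff.1 (hE hy)
    exact h m hy
  simp only [isLowest_iff]
  exact .forall fun m => (hEm.measurable_comp measurable_snd (map_snd m)).imp
    (hd.comp (measurable_fst.prodMk (measurable_snd.prodMk (map_snd m))))

theorem measurable_toLowest [LinearOrder α] (hE : E ≤ R) (hEm : IsBorelRel E)
    (hd : Measurable fun p : Z × X × X => d p.1 p.2.1 ≤ d p.1 p.2.2) :
    Measurable fun p : Z × X => e.toLowest E (d p.1) p.2 :=
  e.measurable_first (P := fun p z => E p.2 z ∧ IsLowest E (d p.1) z)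
    ((hEm.measurable_comp (measurable_snd.comp measurable_fst) measurable_snd).and
      ((e.measurable_isLowest hE hEm hd).comp
        ((measurable_fst.comp measurable_fst).prodMk measurable_snd)))
    measurable_snd

end

variable [Countable I] {E : I → Setoid X} {S : Setoid X} {d : Z → X → ℕ}
  (hE : ∀ i, E i ≤ R) (hEm : ∀ i, IsBorelRel (E i)) (hS : IsBorelRel S)
  (hd : Measurable fun p : Z × X => d p.1 p.2)

include e hE hEm hS in
theorem measurable_classDist : Measurable fun p : X × X => classDist E S p.1 p.2 :=
  measurable_nat_sInf fun n => e.measurable_reachesIn (fun _ _ ⟨i, h⟩ => hE i h)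
    (.exists fun i => measurableSet_setOfPred.1 (hEm i)) (measurableSet_setOfPred.1 hS) n

section

include hE hEm hd

theorem measurable_parent : Measurable fun p : Z × X => e.parent E (d p.1) p.2 := by
  have low i := e.measurable_isLowest (hE i) (hEm i) (measurable_apply_le hd)
  exact e.measurable_first
    (P := fun p z => ∃ i, E i p.2 z ∧ IsLowest (E i) (d p.1) z ∧ ¬IsLowest (E i) (d p.1) p.2)
    (.exists fun i =>
      ((hEm i).measurable_comp (measurable_snd.comp measurable_fst) measurable_snd).and <|
        ((low i).comp ((measurable_fst.comp measurable_fst).prodMk measurable_snd)).and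
          ((low i).comp measurable_fst).not)
    measurable_snd

theorem measurable_root : Measurable fun p : Z × X => e.root E (d p.1) p.2 := by
  have iterate (n : ℕ) : Measurable fun p : Z × X => (e.parent E (d p.1))^[n] p.2 := by
    induction n with
    | zero => exact measurable_snd
    | succ n ih =>
      simp only [Function.iterate_succ_apply']
      exact (e.measurable_parent hE hEm hd).comp (measurable_fst.prodMk ih)
  exact (measurable_from_prod_countable_right
    (f := fun q : ℕ × Z × X => (e.parent E (d q.2.1))^[q.1] q.2.2) iterate).comp
      (hd.prodMk measurable_id)

variable [StandardBorelSpace X]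

theorem measurable_rootIndex : Measurable fun p : Z × X => e.rootIndex E (d p.1) p.2 :=
  measurable_nat_sInf fun n =>
    ((e.map n).measurable.comp (e.measurable_root hE hEm hd)).eq measurable_snd

theorem measurable_rank_le :
    Measurable fun p : Z × X × X => e.rank E (d p.1) p.2.1 ≤ e.rank E (d p.1) p.2.2 := by
  have hfst : Measurable fun p : Z × X × X => (p.1, p.2.1) := by fun_prop
  have hsnd : Measurable fun p : Z × X × X => (p.1, p.2.2) := by fun_prop
  have index_fst := (e.measurable_rootIndex hE hEm hd).comp hfst
  have index_snd := (e.measurable_rootIndex hE hEm hd).comp hsnd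
  simp only [rank, Prod.Lex.toLex_le_toLex]
  exact (measurableSet_setOfPred.1 (measurableSet_lt (hd.comp hfst) (hd.comp hsnd))).or <|
    ((hd.comp hfst).eq (hd.comp hsnd)).and (index_fst.le' index_snd)

theorem measurable_base (i : I) : Measurable fun p : Z × X => e.base E (d p.1) i p.2 := by
  have hlow := e.measurable_toLowest (hE i) (hEm i) (measurable_apply_le hd)
  have hrank := e.measurable_toLowest (d := fun z => e.rank E (d z)) (hE i) (hEm i)
    (e.measurable_rank_le hE hEm hd)
  exact hrank.comp (measurable_fst.prodMk hlow)

end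

variable [StandardBorelSpace X]

section

include hE hEm hS

theorem measurableSet_kuroshDom (i : I) (k : ℕ) : MeasurableSet (e.kuroshDom E S i k) := by
  have hd := e.measurable_classDist hE hEm hS
  have hmap : Measurable fun x => (x, e.map k x) := measurable_id.prodMk (e.map k).measurable
  have hroot := (e.measurable_root hE hEm hd).comp hmap
  have hindex := (e.measurable_rootIndex hE hEm hd).comp hmap
  have hlow := (e.measurable_isLowest (d := fun x => e.rank E (classDist E S x)) (hE i) (hEm i)
    (e.measurable_rank_le hE hEm hd)).comp hmap
  exact measurableSet_setOfPred.2 <|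
    (hroot.eq measurable_id).and <| (hindex.eq measurable_const).and hlow

theorem kuroshMap_mem_fullPseudogroup (i : I) (k : ℕ) :
    e.kuroshMap E S i k ∈ fullPseudogroup R :=
  have hdom := e.measurableSet_kuroshDom hE hEm hS i k
  ⟨hdom, (e.map k).measurableSet_image.2 hdom, (e.map k).measurable.comp measurable_subtype_coe,
    (e.map k).symm.measurable.comp measurable_subtype_coe, fun x _ => e.rel_map k x⟩

theorem measurable_rootEdge : Measurable fun p : X × X => e.RootEdge E S p.1 p.2 := by
  have hd := e.measurable_classDist hE hEm hS
  have hroot := e.measurable_root hE hEm hd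
  have map_fst m : Measurable fun p : X × X => (p.1, e.map m p.1) :=
    measurable_fst.prodMk ((e.map m).measurable.comp measurable_fst)
  have rootEdge_iff (p : X × X) : e.RootEdge E S p.1 p.2 ↔ ∃ i m,
      e.root E (classDist E S p.1) (e.map m p.1) = p.1 ∧
      e.root E (classDist E S p.1) (e.base E (classDist E S p.1) i (e.map m p.1)) = p.2 :=
    exists_congr fun i => e.exists_iff_exists_map fun y h => by
      simpa only [h.1] using R.symm (e.rel_root (E := E) (d := classDist E S p.1) y)
  simp only [rootEdge_iff]
  exact .exists fun i => .exists fun m => ((hroot.comp (map_fst m)).eq measurable_fst).and <|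
    (hroot.comp (measurable_fst.prodMk ((e.measurable_base hE hEm hd i).comp (map_fst m)))).eq
      measurable_snd

theorem measurable_rootGraph_adj : Measurable fun p : X × X => (e.rootGraph E S).Adj p.1 p.2 := by
  have hedge := e.measurable_rootEdge hE hEm hS
  have hne : Measurable fun p : X × X => p.1 ≠ p.2 := (measurable_fst.eq measurable_snd).not
  have hedge_swap := hedge.comp measurable_swap
  exact hne.and (hedge.or hedge_swap)

end

include hEm hS in
theorem isBorelRel_reachableSetoid_rootGraph (hfree : IsFreeProduct R fun i => E i) (hSR : S ≤ R) :
    IsBorelRel (e.rootGraph E S).reachableSetoid := by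
  have reachable_iff (p : X × X) : (e.rootGraph E S).reachableSetoid p.1 p.2 ↔
      ∃ n, ReachesIn (e.rootGraph E S).Adj (· = p.2) n p.1 := by
    rw [exists_reachesIn_iff]
    simp only [exists_eq_right]
    exact SimpleGraph.reachable_iff_reflTransGen p.1 p.2
  have reachesIn (n : ℕ) : Measurable fun p : X × X =>
      ReachesIn (e.rootGraph E S).Adj (· = p.1) n p.2 :=
    e.measurable_reachesIn (P := fun y x => x = y)
      (fun x y h => hSR (e.rel_of_rootGraph_adj hfree h))
      (e.measurable_rootGraph_adj hfree.factor_le hEm hS) (measurable_snd.eq measurable_fst) n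
  refine measurableSet_setOfPred.2 ?_
  simp only [reachable_iff]
  exact .exists fun n => (reachesIn n).comp measurable_swap

end ClassEnumeration

end Measurability

theorem mainTheorem1 {X : Type*} [MeasurableSpace X] [StandardBorelSpace X]
    {I : Type*} [Countable I]
    (R : Setoid X) (hR : IsBorelRel R) (hRc : HasCountableClasses R)
    (Rsub : I → Setoid X) (hRsub : ∀ i, IsBorelRel (Rsub i))
    (hfree : IsFreeProduct R (fun i x y => Rsub i x y))
    (S : Setoid X) (hS : IsBorelRel S) (hSR : S ≤ R) :
    ∃ (K : I → Type) (φ : (i : I) → K i → PartialEquiv X X) (T : Setoid X),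
      (∀ i, Countable (K i)) ∧
      (∀ i k, φ i k ∈ fullPseudogroup R) ∧
      IsBorelRel T ∧ T ≤ S ∧ IsTreeable T ∧
      IsFreeProduct S
        (Sum.elim (fun p : (i : I) × K i => kuroshFactor (Rsub p.1) S (φ p.1 p.2))
          (fun (_ : Unit) x y => T x y)) ∧
      ∀ i, ∃ k, (φ i k).source = Set.univ ∧
        ∀ x y, kuroshFactor (Rsub i) S (φ i k) x y ↔ (Rsub i x y ∧ S x y) := by
  obtain ⟨e⟩ := nonempty_classEnumeration hR hRc
  refine ⟨fun _ => ℕ, e.kuroshMap Rsub S, (e.rootGraph Rsub S).reachableSetoid,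
    fun _ => inferInstance, e.kuroshMap_mem_fullPseudogroup hfree.factor_le hRsub hS,
    e.isBorelRel_reachableSetoid_rootGraph hRsub hS hfree hSR,
    e.reachableSetoid_rootGraph_le hfree, ?treeable, e.isFreeProduct_kurosh hfree hSR,
    fun i => ⟨0, e.kuroshDom_zero i, fun x y => ?_⟩⟩
  case treeable =>
    exact ⟨e.rootGraph Rsub S,
      measurableSet_setOfPred.2 (e.measurable_rootGraph_adj hfree.factor_le hRsub hS),
      e.isAcyclic_rootGraph hfree, fun _ _ => Iff.rfl⟩
  simp [e.kuroshFactor_kuroshMap_iff, e.kuroshDom_zero, e.map_zero]
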